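/- Conventions. Let $\mathbb F$ be a field. An algorithm over $\mathbb F$ accesses the field elements of its input only through the operations $+,-,\times,/$ on elements already available, field constants, and tests whether an element is $0$ (it is an algebraic computation tree over $\mathbb F$, where $a/0:=0$); its cost is the number of these operations and tests that it performs, while work on purely combinatorial data is not counted. Let $\omega$ be a real number for which there is a constant $C_0$ such that for every $n$ two $n\times n$ matrices over $\mathbb F$ can be multiplied by a straight-line program with at most $C_0n^{\omega}$ field operations ($\omega$ is an exponent of matrix multiplication over $\mathbb F$). A linear matroid $M=(E,\mathcal I)$ of rank $k$ is given by a representation over $\mathbb F$, that is, by a $k\times|E|$ matrix $A_M$ over $\mathbb F$ whose columns are indexed by the finite set $E$, such that $X\subseteq E$ is independent in $M$ if and only if the columns indexed by $X$ are linearly independent. For families $\mathcal A,\mathcal B$ of independent sets let $$\mathcal A\bullet\mathcal B=\{X\cup Y : X\in\mathcal A,\ Y\in\mathcal B,\ X\cap Y=\emptyset,\ X\cup Y\in\mathcal I\}.$$ For a family $\mathcal S$ of subsets of $E$ and a weight function $w:\mathcal S\to\mathbb N$, a subfamily $\widehat{\mathcal S}\subseteq\mathcal S$ is min $q$-representative for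 $\mathcal S$, written $\widehat{\mathcal S}\subseteq_{minrep}^{q}\mathcal S$, if for every $Y\subseteq E$ with $|Y|\le q$ and every $X\in\mathcal S$ with $X\cap Y=\emptyset$ and $X\cup Y\in\mathcal I$ there is $\widehat X\in\widehat{\mathcal S}$ with $\widehat X\cap Y=\emptyset$, $\widehat X\cup Y\in\mathcal I$ and $w(\widehat X)\le w(X)$. Statement. Let $c\ge 0$ be a fixed integer. Let $M=(E,\mathcal I)$ be a linear matroid of rank $k$, given by a representation $A_M$ over $\mathbb F$ as above, and let $\mathcal L_1,\mathcal L_2$ be two families of independent sets of $M$ such that, for every $p$, each of them has at most $\binom{k+c}{p}$ members of size $p$. For $r\in\{1,2\}$ let $\mathcal L_{r,i}$ be the family of the sets of size exactly $i$ in $\mathcal L_r$, and for all $0\le i,j\le k$ let a weight function $w_{i,j}:\mathcal L_{1,i}\bullet\mathcal L_{2,j}\to\mathbb N$ be given. Then, for all pairs $i,j\in\{0,\dots,k\}$ together, one can find families $$\widehat{\mathcal L_{1,i}\bullet\mathcal L_{2,j}}\ \subseteq_{minrep}^{\,k-i-j}\ \mathcal L_{1,i}\bullet\mathcal L_{2,j}$$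 with respect to $w_{i,j}$, of size at most $\binom{k}{i+j}$, in a total of $$\mathcal O\left(k^{\omega}\left(2^{\omega}+2\right)^k+k^{\omega}\,2^{k(\omega-1)}\,3^k\right)$$ operations over $\mathbb F$, where the constant hidden in $\mathcal O$ depends only on $c$, $\omega$ and $C_0$. (If $i+j>k$, then $\mathcal L_{1,i}\bullet\mathcal L_{2,j}$ and the family found for it are empty.) -/

import Mathlib

universe u v

/-! ### Counting field operations

Straight-line programs and computation trees over a field `F`. The field elements of the input are
indexed by `ι` and sit in read-only registers `Sum.inl i`; the work registers are `Sum.inr d`. -/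

namespace FieldComp

/-- The arithmetic operations of a field. -/
inductive FieldOp where
  | add
  | sub
  | mul
  | div

/-- The value of an arithmetic operation. Division is total with `a / 0 = 0`; a program may avoid
this case by a zero test. -/
def FieldOp.eval {F : Type u} [Field F] : FieldOp → F → F → F
  | .add, a, b => a + b
  | .sub, a, b => a - b
  | .mul, a, b => a * b
  | .div, a, b => a / b

/-- Registers: the input registers, indexed by `ι`, and the work registers, indexed by `ℕ`. -/
abbrev Reg (ι : Type v) : Type v := ι ⊕ ℕ

/-- One instruction. Only the work register `d` is written. -/
inductive Instr (F : Type u) (ι : Type v) where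
  /-- Write the constant `a` into the work register `d`. -/
  | const (d : ℕ) (a : F)
  /-- Write the value of the operation `o` on the contents of `x` and `y` into `d`. -/
  | arith (o : FieldOp) (d : ℕ) (x y : Reg ι)

/-- The initial memory: the input in the input registers, `0` in the work registers. -/
def initMem {F : Type u} [Field F] {ι : Type v} (input : ι → F) : Reg ι → F :=
  Sum.elim input (fun _ => 0)

open Classical in
/-- The memory after one instruction. -/
noncomputable def Instr.exec {F : Type u} [Field F] {ι : Type v} (s : Instr F ι)
    (m : Reg ι → F) : Reg ι → F :=
  match s with
  | .const d a => Function.update m (Sum.inr d) a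
  | .arith o d x y => Function.update m (Sum.inr d) (o.eval (m x) (m y))

/-- The memory after a straight-line program (a list of instructions). -/
noncomputable def execList {F : Type u} [Field F] {ι : Type v} (P : List (Instr F ι))
    (m : Reg ι → F) : Reg ι → F :=
  P.foldl (fun m s => s.exec m) m

/-- Two `n × n` matrices over `F` can be multiplied by a straight-line program with at most
`C₀ * n ^ ω` operations, for every `n`: the (real) number `ω` is an exponent of matrix
multiplication over `F`, with constant `C₀`. The program for `n` reads off the product from the
registers `out i j`. -/
def MatMulExponent (F : Type u) [Field F] (ω C₀ : ℝ) : Prop :=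
  ∀ n : ℕ, ∃ (P : List (Instr F ((Fin n × Fin n) ⊕ (Fin n × Fin n))))
    (out : Fin n → Fin n → Reg ((Fin n × Fin n) ⊕ (Fin n × Fin n))),
    (P.length : ℝ) ≤ C₀ * (n : ℝ) ^ ω ∧
    ∀ (A B : Matrix (Fin n) (Fin n) F) (i j : Fin n),
      execList P (initMem (Sum.elim (fun p => A p.1 p.2) (fun p => B p.1 p.2))) (out i j) =
        (A * B) i j

/-- An algebraic computation tree with inputs from `F` indexed by `ι` and results in `β`. It
accesses the input only through field operations and zero tests. -/
inductive CompTree (F : Type u) (ι : Type v) (β : Type v) where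
  /-- Stop with the result `b`. -/
  | ret (b : β)
  /-- Execute an instruction, then continue. -/
  | step (s : Instr F ι) (t : CompTree F ι β)
  /-- Continue with `t₀` if the register `x` contains `0`, and with `t₁` otherwise. -/
  | test (x : Reg ι) (t₀ t₁ : CompTree F ι β)

open Classical in
/-- The result of a computation tree started on the memory `m`. -/
noncomputable def CompTree.result {F : Type u} [Field F] {ι β : Type v} :
    CompTree F ι β → (Reg ι → F) → β
  | .ret b, _ => b
  | .step s t, m => t.result (s.exec m)
  | .test x t₀ t₁, m => if m x = 0 then t₀.result m else t₁.result m

open Classical in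
/-- The number of operations over `F` (instructions and zero tests) that a computation tree
performs when it is started on the memory `m`. -/
noncomputable def CompTree.cost {F : Type u} [Field F] {ι β : Type v} :
    CompTree F ι β → (Reg ι → F) → ℕ
  | .ret _, _ => 0
  | .step s t, m => t.cost (s.exec m) + 1
  | .test x t₀ t₁, m => (if m x = 0 then t₀.cost m else t₁.cost m) + 1

end FieldComp

/-! ### Linear matroids and representative families -/

namespace RepFamily

/-- The matrix `A`, with a column for each element of the ground set `E`, represents the matroid
`M` on `E` over `F`: a set is independent if and only if its columns are linearly independent. -/
def Represents {F : Type u} [Field F] {E : Type v} {k : ℕ} (A : Matrix (Fin k) E F)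
    (M : Matroid E) : Prop :=
  M.E = Set.univ ∧ ∀ X : Set E, M.Indep X ↔ LinearIndepOn F A.col X

/-- The product family `L₁ • L₂` of two families of independent sets of `M`. -/
def product {E : Type v} [DecidableEq E] (M : Matroid E) (L₁ L₂ : Finset (Finset E)) :
    Set (Finset E) :=
  {Z | ∃ X ∈ L₁, ∃ Y ∈ L₂, Disjoint X Y ∧ M.Indep (↑(X ∪ Y) : Set E) ∧ Z = X ∪ Y}

/-- `T` is a min `q`-representative subfamily of `S` with respect to the weight `w`. -/
def IsMinRep {E : Type v} [DecidableEq E] (M : Matroid E) (q : ℕ) (w : Finset E → ℕ)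
    (T S : Set (Finset E)) : Prop :=
  T ⊆ S ∧ ∀ Y : Finset E, Y.card ≤ q →
    ∀ X ∈ S, Disjoint X Y → M.Indep (↑(X ∪ Y) : Set E) →
      ∃ X' ∈ T, Disjoint X' Y ∧ M.Indep (↑(X' ∪ Y) : Set E) ∧ w X' ≤ w X

end RepFamily

/-! In a space of dimension d, a set of j vectors is encoded by its exterior product, a row with
binom(d,j) coordinates. A complement of d-j vectors acts on such rows as a linear functional (wedge
with it and take the top coordinate), nonzero exactly when the combined list is independent. Hence a
basis of the rows chosen greedily by increasing weight is min representative: a functional that is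
nonzero at the row of X is nonzero at some chosen row of weight at most w(X), because such rows span
that of X (`extProd_exchange`, `MatMulExponent.feasible_select`). The basis has at most binom(d,j)
members.

Applied directly to a product family this meets far too many rows, so there are two rounds. For each
X in the first family, the sets Y disjoint from X are thinned in the contraction M/X, of rank k-i,
with weight w(X ∪ Y); at most binom(k-i,j) survive. The union over X is thinned again in M.
Exchanging Y for Y' and then X ∪ Y' for Z shows correctness (`isMinRep_product`). With z = 2^(ω-1),
and up to constants and k^ω, the first round costs Σ binom(k+c,i) z^(k-i) binom(k+c,j) ≤
(2+2z)^(k+c) = (2^ω+2)^(k+c), the second z^k Σ binom(k+c,i) binom(k-i,j) ≤ z^k 3^(k+c)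
(`sum_pairCost_le`).

A greedy basis of m ≤ 2^n rows with d columns costs O(m d^(ω-1) (n+1)) by halving the list and using
fast matrix products (`MatMulExponent.feasible_rowBasis`). Since ω ≥ 2 (`MatMulExponent.two_le`),
the remaining polynomial factors fit into k^ω.

Costs are tracked in continuation style: `Feasible` keeps the set D of inputs that reach the current
branch and the set G of functions of the input held in registers; `Derives` describes a branch-free
segment that may precede any continuation. -/

namespace FieldComp

/-! ### A calculus for the cost of computation trees -/

section Framework

variable {F : Type u} [Field F] {ι : Type v} {β : Type v} {Ω : Type*}

variable (ι) in
/-- On the inputs in `D`, with the quantities in `G` stored in registers, the goal `Q` can be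
reached by a computation tree of cost at most `c`. -/
def Feasible (D : Set Ω) (G : Set (Ω → F)) (c : ℝ) (Q : Ω → β → Prop) : Prop :=
  ∀ (loc : (Ω → F) → Reg ι) (N : ℕ), (∀ g ∈ G, ∀ d, loc g = Sum.inr d → d < N) →
    ∃ t : CompTree F ι β, ∀ x ∈ D, ∀ m : Reg ι → F, (∀ g ∈ G, m (loc g) = g x) →
      Q x (t.result m) ∧ (t.cost m : ℝ) ≤ c

theorem Feasible.mono {D D' : Set Ω} {G G' : Set (Ω → F)} {c c' : ℝ} {Q : Ω → β → Prop}
    (h : Feasible ι D G c Q) (hD : D' ⊆ D) (hG : G ⊆ G') (hc : c ≤ c') :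
    Feasible ι D' G' c' Q := by
  intro loc N hN
  obtain ⟨t, ht⟩ := h loc N fun g hg => hN g (hG hg)
  exact ⟨t, fun x hx m hm => ⟨(ht x (hD hx) m fun g hg => hm g (hG hg)).1,
    (ht x (hD hx) m fun g hg => hm g (hG hg)).2.trans hc⟩⟩

theorem Feasible.ret {D : Set Ω} {G : Set (Ω → F)} {Q : Ω → β → Prop} (b : β)
    (h : ∀ x ∈ D, Q x b) : Feasible ι D G 0 Q := by
  intro loc N _
  exact ⟨.ret b, fun x hx m _ => ⟨h x hx, by simp [CompTree.cost]⟩⟩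

/-- Inputs that cannot occur need no computation. -/
theorem Feasible.of_nonempty [Nonempty β] {D : Set Ω} {G : Set (Ω → F)} {c : ℝ}
    {Q : Ω → β → Prop} (h : D.Nonempty → Feasible ι D G c Q) : Feasible ι D G c Q := by
  rcases D.eq_empty_or_nonempty with rfl | hD
  · intro loc N _
    exact ⟨.ret (Classical.arbitrary β), fun x hx => absurd hx (Set.notMem_empty x)⟩
  · exact h hD

-- Register N is above every work register in use, so writing to it destroys no stored quantity; the
-- continuation then starts from N + 1.
open Classical in
theorem Feasible.step {D : Set Ω} {G : Set (Ω → F)} {c : ℝ} {Q : Ω → β → Prop} (s : Ω → F)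
    (instr : ((Ω → F) → Reg ι) → ℕ → Instr F ι)
    (hs : ∀ loc N, ∀ x ∈ D, ∀ m : Reg ι → F, (∀ g ∈ G, m (loc g) = g x) →
      (instr loc N).exec m = Function.update m (Sum.inr N) (s x))
    (h : Feasible ι D (insert s G) c Q) : Feasible ι D G (c + 1) Q := by
  intro loc N hN
  obtain ⟨t, ht⟩ := h (Function.update loc s (Sum.inr N)) (N + 1) (by
    intro g hg d hd
    by_cases hgs : g = s
    · subst hgs
      simp only [Function.update_self, Sum.inr.injEq] at hd
      omega
    · rw [Function.update_of_ne hgs] at hd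
      have := hN g (by simpa [hgs] using hg) d hd
      omega)
  refine ⟨.step (instr loc N) t, fun x hx m hm => ?_⟩
  have key := ht x hx ((instr loc N).exec m) (by
    intro g hg
    rw [hs loc N x hx m hm]
    by_cases hgs : g = s
    · subst hgs
      simp
    · have hgG : g ∈ G := by simpa [hgs] using hg
      rw [Function.update_of_ne hgs, Function.update_of_ne, hm g hgG]
      intro hl
      exact lt_irrefl _ (hN g hgG N hl))
  refine ⟨key.1, ?_⟩
  have := key.2
  simp only [CompTree.cost, Nat.cast_add, Nat.cast_one]
  linarith

theorem Feasible.const {D : Set Ω} {G : Set (Ω → F)} {c : ℝ} {Q : Ω → β → Prop} (a : F)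
    (h : Feasible ι D (insert (fun _ => a) G) c Q) : Feasible ι D G (c + 1) Q :=
  Feasible.step (fun _ => a) (fun _ N => .const N a) (by intros; rfl) h

theorem Feasible.arith {D : Set Ω} {G : Set (Ω → F)} {c : ℝ} {Q : Ω → β → Prop} (o : FieldOp)
    {f g : Ω → F} (hf : f ∈ G) (hg : g ∈ G)
    (h : Feasible ι D (insert (fun x => o.eval (f x) (g x)) G) c Q) :
    Feasible ι D G (c + 1) Q :=
  Feasible.step _ (fun loc N => .arith o N (loc f) (loc g)) (by
    intro loc N x _ m hm
    simp only [Instr.exec, hm f hf, hm g hg]) h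

/-- Each branch has to succeed only on the inputs that reach it, and the two branches share the cost
bound c because only one of them is run. -/
theorem Feasible.test {D : Set Ω} {G : Set (Ω → F)} {c : ℝ} {Q : Ω → β → Prop}
    {g : Ω → F} (hg : g ∈ G) (h₀ : Feasible ι {x ∈ D | g x = 0} G c Q)
    (h₁ : Feasible ι {x ∈ D | g x ≠ 0} G c Q) : Feasible ι D G (c + 1) Q := by
  intro loc N hN
  obtain ⟨t₀, ht₀⟩ := h₀ loc N hN
  obtain ⟨t₁, ht₁⟩ := h₁ loc N hN
  refine ⟨.test (loc g) t₀ t₁, fun x hx m hm => ?_⟩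
  by_cases h : g x = 0
  · have := ht₀ x ⟨hx, h⟩ m hm
    simp only [CompTree.result, CompTree.cost, hm g hg, h, if_true]
    push_cast
    exact ⟨this.1, by linarith [this.2]⟩
  · have := ht₁ x ⟨hx, h⟩ m hm
    simp only [CompTree.result, CompTree.cost, hm g hg, h, if_false]
    push_cast
    exact ⟨this.1, by linarith [this.2]⟩

/-- Search a list of quantities for a nonzero one. -/
theorem Feasible.find {κ : Type*} {G : Set (Ω → F)} {c : ℝ} {Q : Ω → β → Prop} (v : κ → Ω → F)
    (l : List κ) (hv : ∀ j ∈ l, v j ∈ G) (D : Set Ω)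
    (h₀ : Feasible ι {x ∈ D | ∀ j ∈ l, v j x = 0} G c Q)
    (h₁ : ∀ j ∈ l, Feasible ι {x ∈ D | v j x ≠ 0} G c Q) :
    Feasible ι D G (c + l.length) Q := by
  induction l generalizing D with
  | nil => exact h₀.mono (fun x hx => ⟨hx, by simp⟩) subset_rfl (by simp)
  | cons j l ih =>
    have := Feasible.test (hv j (by simp))
      (ih (fun i hi => hv i (by simp [hi])) {x ∈ D | v j x = 0}
        (h₀.mono (fun x hx => ⟨hx.1.1, by
          intro i hi
          rcases List.mem_cons.1 hi with rfl | hi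
          exacts [hx.1.2, hx.2 i hi]⟩) subset_rfl le_rfl)
        (fun i hi => (h₁ i (by simp [hi])).mono (fun x hx => ⟨hx.1.1, hx.2⟩) subset_rfl le_rfl))
      ((h₁ j (by simp)).mono subset_rfl subset_rfl (by simp))
    refine this.mono subset_rfl subset_rfl ?_
    simp only [List.length_cons]
    push_cast
    linarith

variable (ι) in
/-- The quantities in `T` can be derived from those in `G` by at most `n` operations without
branching. -/
def Derives (G T : Set (Ω → F)) (n : ℝ) : Prop :=
  ∀ ⦃β : Type v⦄ ⦃D : Set Ω⦄ ⦃G' : Set (Ω → F)⦄ ⦃c : ℝ⦄ ⦃Q : Ω → β → Prop⦄, G ⊆ G' →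
    Feasible ι D (G' ∪ T) c Q → Feasible ι D G' (c + n) Q

theorem Derives.mono {G G' T T' : Set (Ω → F)} {n n' : ℝ} (h : Derives ι G T n) (hG : G ⊆ G')
    (hT : T' ⊆ T) (hn : n ≤ n') : Derives ι G' T' n' := by
  intro β D H c Q hH hf
  exact (h (hG.trans hH) (hf.mono subset_rfl (Set.union_subset_union_right _ hT) le_rfl)).mono
    subset_rfl subset_rfl (by linarith)

theorem Derives.of_subset {G T : Set (Ω → F)} (h : T ⊆ G) : Derives ι G T 0 := by
  intro β D H c Q hH hf
  exact hf.mono subset_rfl (Set.union_subset subset_rfl (h.trans hH)) (by simp)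

theorem Derives.trans {G T T' : Set (Ω → F)} {n n' : ℝ} (h : Derives ι G T n)
    (h' : Derives ι (G ∪ T) T' n') : Derives ι G T' (n + n') := by
  intro β D H c Q hH hf
  have := h hH (h' (Set.union_subset_union_left _ hH)
    (hf.mono subset_rfl (Set.union_subset_union_left _ Set.subset_union_left) le_rfl))
  exact this.mono subset_rfl subset_rfl (by linarith)

theorem Derives.union {G T T' : Set (Ω → F)} {n n' : ℝ} (h : Derives ι G T n)
    (h' : Derives ι (G ∪ T) T' n') : Derives ι G (T ∪ T') (n + n') := by
  intro β D H c Q hH hf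
  have := h hH (h' (Set.union_subset_union_left _ hH)
    (hf.mono subset_rfl (Set.union_assoc _ _ _).symm.subset le_rfl))
  exact this.mono subset_rfl subset_rfl (by linarith)

theorem Derives.biUnion {α : Type*} {G : Set (Ω → F)} (s : Finset α) {T : α → Set (Ω → F)}
    {n : α → ℝ} (h : ∀ a ∈ s, Derives ι G (T a) (n a)) :
    Derives ι G (⋃ a ∈ s, T a) (∑ a ∈ s, n a) := by
  classical
  induction s using Finset.induction_on with
  | empty => exact Derives.of_subset (by simp)
  | insert a s ha ih =>
    rw [Finset.sum_insert ha, Finset.set_biUnion_insert]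
    exact (h a (by simp)).union ((ih fun b hb => h b (by simp [hb])).mono
      Set.subset_union_left subset_rfl le_rfl)

theorem Derives.range {α : Type*} {G : Set (Ω → F)} (s : Finset α) {f : α → Ω → F} {n : ℝ}
    (h : ∀ a ∈ s, Derives ι G {f a} n) : Derives ι G {g | ∃ a ∈ s, f a = g} (s.card * n) := by
  refine (Derives.biUnion s (n := fun _ => n) h).mono subset_rfl ?_ (by simp)
  rintro g ⟨a, ha, rfl⟩
  simp only [Set.mem_iUnion]
  exact ⟨a, ha, rfl⟩

theorem Derives.const {G : Set (Ω → F)} (a : F) : Derives ι G {fun _ => a} 1 := by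
  intro β D H c Q hH hf
  exact Feasible.const a (hf.mono subset_rfl (by simp) le_rfl)

theorem Derives.arith {G : Set (Ω → F)} {f g : Ω → F} (o : FieldOp) (hf : f ∈ G) (hg : g ∈ G) :
    Derives ι G {fun x => o.eval (f x) (g x)} 1 := by
  intro β D H c Q hH h
  exact Feasible.arith o (hH hf) (hH hg) (h.mono subset_rfl (by simp) le_rfl)

theorem Derives.add {G : Set (Ω → F)} {f g : Ω → F} (hf : f ∈ G) (hg : g ∈ G) :
    Derives ι G {f + g} 1 := Derives.arith .add hf hg

theorem Derives.sub {G : Set (Ω → F)} {f g : Ω → F} (hf : f ∈ G) (hg : g ∈ G) :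
    Derives ι G {f - g} 1 := Derives.arith .sub hf hg

theorem Derives.mul {G : Set (Ω → F)} {f g : Ω → F} (hf : f ∈ G) (hg : g ∈ G) :
    Derives ι G {f * g} 1 := Derives.arith .mul hf hg

theorem Derives.div {G : Set (Ω → F)} {f g : Ω → F} (hf : f ∈ G) (hg : g ∈ G) :
    Derives ι G {f / g} 1 := Derives.arith .div hf hg

theorem Derives.sum {α : Type*} {G : Set (Ω → F)} (s : Finset α) {f : α → Ω → F} {n : ℝ}
    (h : ∀ a ∈ s, Derives ι G {f a} n) : Derives ι G {∑ a ∈ s, f a} (s.card * (n + 1) + 1) := by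
  classical
  induction s using Finset.induction_on with
  | empty =>
    simp only [Finset.sum_empty, Finset.card_empty, Nat.cast_zero, zero_mul, zero_add]
    exact Derives.const (0 : F)
  | insert a s ha ih =>
    rw [Finset.sum_insert ha, Finset.card_insert_of_notMem ha]
    have h₁ := (ih fun b hb => h b (by simp [hb])).union
      ((h a (by simp)).mono (Set.subset_union_left (t := {∑ b ∈ s, f b})) subset_rfl le_rfl)
    have h₂ := h₁.trans (Derives.add (f := f a) (g := ∑ b ∈ s, f b) (by simp) (by simp))
    refine h₂.mono subset_rfl subset_rfl ?_
    push_cast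
    linarith

open Classical in
/-- A straight-line program can be run on available quantities. -/
theorem Derives.execList {ι' : Type*} {G : Set (Ω → F)} (P : List (Instr F ι'))
    (μ : Reg ι' → Ω → F) (hμ : ∀ r, μ r ∈ G) :
    Derives ι G (Set.range fun r x => FieldComp.execList P (fun r => μ r x) r) P.length := by
  induction P generalizing G μ with
  | nil =>
    refine (Derives.of_subset ?_).mono subset_rfl subset_rfl (by simp)
    rintro _ ⟨r, rfl⟩
    exact hμ r
  | cons s P ih =>
    obtain ⟨d, g, hg, hs⟩ : ∃ (d : ℕ) (g : Ω → F), Derives ι G {g} 1 ∧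
        ∀ x, s.exec (fun r => μ r x) = Function.update (fun r => μ r x) (Sum.inr d) (g x) := by
      cases s with
      | const d a => exact ⟨d, fun _ => a, Derives.const a, fun x => rfl⟩
      | arith o d y z => exact ⟨d, _, Derives.arith o (hμ y) (hμ z), fun x => rfl⟩
    have := hg.trans (ih (G := G ∪ {g}) (Function.update μ (Sum.inr d) g) (by
      intro r
      by_cases hr : r = Sum.inr d
      · subst hr
        simp
      · rw [Function.update_of_ne hr]
        exact Or.inl (hμ r)))
    refine this.mono subset_rfl ?_ (by push_cast [List.length_cons]; linarith)
    rintro _ ⟨r, rfl⟩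
    refine ⟨r, ?_⟩
    funext x
    simp only [FieldComp.execList, List.foldl_cons, hs]
    refine congrFun (congrArg (fun m => List.foldl (fun m s => s.exec m) m P) ?_) r
    funext r'
    by_cases hr : r' = Sum.inr d
    · subst hr
      simp
    · rw [Function.update_of_ne hr, Function.update_of_ne hr]

/-- Independent computations for the members of a finite set, one after the other. -/
theorem Feasible.forall_finset {α : Type*} {γ : Type*} [Nonempty γ] {G : Set (Ω → F)}
    {Q : Ω → β → Prop} (P : α → γ → Ω → Prop) (n : α → ℝ) (s : Finset α) {D₀ : Set Ω}
    (h : ∀ a ∈ s, ∀ D ⊆ D₀, ∀ c : ℝ,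
      (∀ o : γ, ∀ D' ⊆ D, (∀ x ∈ D', P a o x) → Feasible ι D' G c Q) → Feasible ι D G (c + n a) Q)
    {D : Set Ω} (hD : D ⊆ D₀) {c : ℝ}
    (H : ∀ o : α → γ, ∀ D' ⊆ D, (∀ x ∈ D', ∀ a ∈ s, P a (o a) x) → Feasible ι D' G c Q) :
    Feasible ι D G (c + ∑ a ∈ s, n a) Q := by
  classical
  induction s using Finset.induction_on generalizing D with
  | empty =>
    exact (H (fun _ => Classical.arbitrary γ) D subset_rfl (by simp)).mono subset_rfl subset_rfl
      (by simp)
  | insert a s ha ih =>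
    refine (h a (by simp) D hD (c + ∑ a ∈ s, n a) fun o D₁ hD₁ ho => ?_).mono subset_rfl subset_rfl
      (by rw [Finset.sum_insert ha]; linarith)
    refine ih (fun b hb => h b (by simp [hb])) (hD₁.trans hD) fun o' D₂ hD₂ ho' => ?_
    refine H (Function.update o' a o) D₂ (hD₂.trans hD₁) fun x hx b hb => ?_
    rcases Finset.mem_insert.1 hb with rfl | hb'
    · simpa using ho x (hD₂ hx)
    · rw [Function.update_of_ne (by rintro rfl; exact ha hb')]
      exact ho' x hx b hb'

end Framework

/-! ### Rectangular matrix products and the bound ω ≥ 2 -/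

section MatrixProduct

variable {F : Type u} [Field F] {ι : Type v} {Ω : Type*}

/-- The work registers that an instruction writes. -/
def Instr.target {ι : Type*} : Instr F ι → ℕ
  | .const d _ => d
  | .arith _ d _ _ => d

theorem execList_inl {ι : Type*} (P : List (Instr F ι)) (m : Reg ι → F) (i : ι) :
    execList P m (Sum.inl i) = m (Sum.inl i) := by
  induction P generalizing m with
  | nil => rfl
  | cons s P ih =>
    have := ih (s.exec m)
    simp only [execList, List.foldl_cons] at this ⊢
    rw [this]
    cases s <;> simp [Instr.exec]

theorem execList_inr {ι : Type*} (P : List (Instr F ι)) (m : Reg ι → F) (d : ℕ)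
    (hd : d ∉ P.map Instr.target) : execList P m (Sum.inr d) = m (Sum.inr d) := by
  induction P generalizing m with
  | nil => rfl
  | cons s P ih =>
    simp only [List.map_cons, List.mem_cons, not_or] at hd
    have := ih (s.exec m) hd.2
    simp only [execList, List.foldl_cons] at this ⊢
    rw [this]
    cases s <;> simp_all [Instr.exec, Instr.target]

/-- A straight-line program for matrix multiplication has at least one operation for each entry
of the product. -/
theorem sq_le_length {n : ℕ} (P : List (Instr F ((Fin n × Fin n) ⊕ (Fin n × Fin n))))
    (out : Fin n → Fin n → Reg ((Fin n × Fin n) ⊕ (Fin n × Fin n)))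
    (h : ∀ (A B : Matrix (Fin n) (Fin n) F) (i j : Fin n),
      execList P (initMem (Sum.elim (fun p => A p.1 p.2) (fun p => B p.1 p.2))) (out i j) =
        (A * B) i j) : n ^ 2 ≤ P.length := by
  classical
  -- The product E_ii E_ij = E_ij has a single nonzero entry. Its output register is no input
  -- register, since that would keep the 1 when the other factor is replaced by 0; it is written,
  -- since it would otherwise hold the initial 0; and it differs from the register of every other
  -- entry, which holds 0.
  have h_unit : ∀ i j i' j' : Fin n,
      (Matrix.single i i (1 : F) * Matrix.single i j (1 : F)) i' j' =
        if i = i' ∧ j = j' then 1 else 0 := by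
    intro i j i' j'
    rw [Matrix.single_mul_single_same, Matrix.single_apply]
    simp
  have h_out : ∀ i j, ∃ d ∈ P.map Instr.target, out i j = Sum.inr d := by
    intro i j
    have h₁ := h (Matrix.single i i 1) (Matrix.single i j 1) i j
    rw [h_unit, if_pos ⟨rfl, rfl⟩] at h₁
    rcases ho : out i j with (p | p) | d
    · have h₂ := h (Matrix.single i i 1) 0 i j
      rw [ho, execList_inl] at h₁ h₂
      simp only [initMem, Sum.elim_inl, mul_zero, Matrix.zero_apply] at h₁ h₂
      exact absurd (h₁.symm.trans h₂) one_ne_zero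
    · have h₂ := h 0 (Matrix.single i j 1) i j
      rw [ho, execList_inl] at h₁ h₂
      simp only [initMem, Sum.elim_inl, Sum.elim_inr, zero_mul, Matrix.zero_apply] at h₁ h₂
      exact absurd (h₁.symm.trans h₂) one_ne_zero
    · refine ⟨d, ?_, rfl⟩
      by_contra hd
      rw [ho, execList_inr _ _ _ hd] at h₁
      simp [initMem] at h₁
  choose d hd hod using h_out
  have h_inj : Function.Injective fun p : Fin n × Fin n => d p.1 p.2 := by
    rintro ⟨i, j⟩ ⟨i', j'⟩ hij
    have h₁ := h (Matrix.single i i 1) (Matrix.single i j 1) i j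
    have h₂ := h (Matrix.single i i 1) (Matrix.single i j 1) i' j'
    dsimp only at hij
    rw [hod, ← hij, ← hod, h₁, h_unit, h_unit, if_pos ⟨rfl, rfl⟩] at h₂
    by_contra hne
    rw [if_neg (by simpa using hne)] at h₂
    exact one_ne_zero h₂
  have h_card := Finset.card_le_card_of_injOn (s := Finset.univ)
    (t := (P.map Instr.target).toFinset) (fun p : Fin n × Fin n => d p.1 p.2)
    (fun p _ => by simpa using hd p.1 p.2) h_inj.injOn
  have h_len := (P.map Instr.target).toFinset_card_le
  simp only [Finset.card_univ, Fintype.card_prod, Fintype.card_fin, List.length_map] at h_card h_len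
  nlinarith

theorem MatMulExponent.sq_le {ω C₀ : ℝ} (h : MatMulExponent F ω C₀) (n : ℕ) :
    (n : ℝ) ^ 2 ≤ C₀ * (n : ℝ) ^ ω := by
  obtain ⟨P, out, hP, hout⟩ := h n
  exact le_trans (by exact_mod_cast sq_le_length P out hout) hP

theorem MatMulExponent.one_le {ω C₀ : ℝ} (h : MatMulExponent F ω C₀) : 1 ≤ C₀ := by
  simpa using h.sq_le 1

/-- If ω < 2, then n^(2-ω) is unbounded, against n² ≤ C₀ n^ω. -/
theorem MatMulExponent.two_le {ω C₀ : ℝ} (h : MatMulExponent F ω C₀) : 2 ≤ ω := by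
  by_contra! hω
  have h_tend : Filter.Tendsto (fun n : ℕ => (n : ℝ) ^ (2 - ω)) Filter.atTop Filter.atTop :=
    (tendsto_rpow_atTop (by linarith)).comp tendsto_natCast_atTop_atTop
  obtain ⟨n, hn, hn₁⟩ := ((h_tend.eventually_gt_atTop C₀).and
    (Filter.eventually_ge_atTop 1)).exists
  have h_pos : (0 : ℝ) < n := by exact_mod_cast hn₁
  have h_sq := h.sq_le n
  rw [Real.rpow_sub h_pos, lt_div_iff₀ (Real.rpow_pos_of_pos h_pos ω)] at hn
  norm_num at hn
  linarith

/-- Computing the quantities indexed by a finite set block by block. -/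
theorem Derives.of_blocks {α : Type*} {G : Set (Ω → F)} (T : α → Set (Ω → F)) (b : ℕ) {n : ℝ}
    (q : ℕ) (s : Finset α) (hs : s.card ≤ q * b)
    (h : ∀ t ⊆ s, t.card ≤ b → Derives ι G (⋃ a ∈ t, T a) n) : Derives ι G (⋃ a ∈ s, T a) (q * n) := by
  classical
  induction q generalizing s with
  | zero =>
    obtain rfl : s = ∅ := by simpa using hs
    exact Derives.of_subset (by simp) |>.mono subset_rfl subset_rfl (by simp)
  | succ q ih =>
    obtain ⟨t, ht, htc⟩ := Finset.exists_subset_card_eq (s := s) (n := min b s.card)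
      (min_le_right _ _)
    have h₁ := h t ht (htc.trans_le (min_le_left _ _))
    have h₂ := ih (s \ t) (by
      rw [Finset.card_sdiff_of_subset ht, htc]
      have : (q + 1) * b = q * b + b := by ring
      omega) fun t' ht' => h t' (ht'.trans Finset.sdiff_subset)
    have := h₁.union (h₂.mono Set.subset_union_left subset_rfl le_rfl)
    rw [← Finset.set_biUnion_union, Finset.union_sdiff_of_subset ht] at this
    refine this.mono subset_rfl subset_rfl ?_
    push_cast
    linarith

theorem exists_injOn_fin {δ : Type*} (s : Finset δ) {b : ℕ} (hb : b ≠ 0) (hs : s.card ≤ b) :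
    ∃ f : δ → Fin b, Set.InjOn f s := by
  classical
  have : NeZero b := ⟨hb⟩
  obtain ⟨f⟩ := Function.Embedding.nonempty_of_card_le (α := s) (β := Fin b) (by simpa using hs)
  refine ⟨fun a => if ha : a ∈ s then f ⟨a, ha⟩ else 0, fun a ha a' ha' haa => ?_⟩
  simp only [Finset.mem_coe] at ha ha'
  simp only [ha, ha', dif_pos] at haa
  exact congrArg Subtype.val (f.injective haa)

open Classical in
/-- The product of two small matrices, indexed by arbitrary finite sets. -/
theorem MatMulExponent.derives_small {ω C₀ : ℝ} (h : MatMulExponent F ω C₀) {α σ κ : Type*}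
    (I : Finset α) (S : Finset σ) (C : Finset κ) (b : ℕ) (hb : b ≠ 0) (hI : I.card ≤ b)
    (hS : S.card ≤ b) (hC : C.card ≤ b) {G : Set (Ω → F)} (A : α → σ → Ω → F) (B : σ → κ → Ω → F)
    (hA : ∀ i ∈ I, ∀ s ∈ S, A i s ∈ G) (hB : ∀ s ∈ S, ∀ j ∈ C, B s j ∈ G) :
    Derives ι G (⋃ i ∈ I, ⋃ j ∈ C, {∑ s ∈ S, A i s * B s j}) ((C₀ + 1) * (b : ℝ) ^ ω) := by
  obtain ⟨P, out, hP, hout⟩ := h b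
  obtain ⟨f, hf⟩ := exists_injOn_fin I hb hI
  obtain ⟨g, hg⟩ := exists_injOn_fin S hb hS
  obtain ⟨k, hk⟩ := exists_injOn_fin C hb hC
  -- Both factors are padded with zeros to size b along the injections f, g, k. All padding uses one
  -- stored constant 0; its cost turns C₀ into C₀ + 1.
  let A' : Fin b → Fin b → Ω → F := fun p q =>
    if hp : ∃ z : α × σ, (z.1 ∈ I ∧ f z.1 = p) ∧ z.2 ∈ S ∧ g z.2 = q then
      A hp.choose.1 hp.choose.2 else 0
  let B' : Fin b → Fin b → Ω → F := fun p q =>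
    if hp : ∃ z : σ × κ, (z.1 ∈ S ∧ g z.1 = p) ∧ z.2 ∈ C ∧ k z.2 = q then
      B hp.choose.1 hp.choose.2 else 0
  have hA' : ∀ i ∈ I, ∀ s ∈ S, A' (f i) (g s) = A i s := by
    intro i hi s hs
    have hp : ∃ z : α × σ, (z.1 ∈ I ∧ f z.1 = f i) ∧ z.2 ∈ S ∧ g z.2 = g s :=
      ⟨(i, s), ⟨hi, rfl⟩, hs, rfl⟩
    simp only [A', dif_pos hp]
    rw [hf hp.choose_spec.1.1 hi hp.choose_spec.1.2, hg hp.choose_spec.2.1 hs hp.choose_spec.2.2]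
  have hB' : ∀ s ∈ S, ∀ j ∈ C, B' (g s) (k j) = B s j := by
    intro s hs j hj
    have hp : ∃ z : σ × κ, (z.1 ∈ S ∧ g z.1 = g s) ∧ z.2 ∈ C ∧ k z.2 = k j :=
      ⟨(s, j), ⟨hs, rfl⟩, hj, rfl⟩
    simp only [B', dif_pos hp]
    rw [hg hp.choose_spec.1.1 hs hp.choose_spec.1.2, hk hp.choose_spec.2.1 hj hp.choose_spec.2.2]
  have hA'G : ∀ p q, A' p q ∈ G ∪ {fun _ => (0 : F)} := by
    intro p q
    by_cases hp : ∃ z : α × σ, (z.1 ∈ I ∧ f z.1 = p) ∧ z.2 ∈ S ∧ g z.2 = q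
    · simp only [A', dif_pos hp]
      exact Or.inl (hA _ hp.choose_spec.1.1 _ hp.choose_spec.2.1)
    · simp only [A', dif_neg hp]
      exact Or.inr rfl
  have hB'G : ∀ p q, B' p q ∈ G ∪ {fun _ => (0 : F)} := by
    intro p q
    by_cases hp : ∃ z : σ × κ, (z.1 ∈ S ∧ g z.1 = p) ∧ z.2 ∈ C ∧ k z.2 = q
    · simp only [B', dif_pos hp]
      exact Or.inl (hB _ hp.choose_spec.1.1 _ hp.choose_spec.2.1)
    · simp only [B', dif_neg hp]
      exact Or.inr rfl
  let μ : Reg ((Fin b × Fin b) ⊕ (Fin b × Fin b)) → Ω → F :=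
    Sum.elim (Sum.elim (fun p => A' p.1 p.2) (fun p => B' p.1 p.2)) (fun _ _ => 0)
  have hμ : ∀ r, μ r ∈ G ∪ {fun _ => (0 : F)} := by
    rintro ((p | p) | d)
    exacts [hA'G _ _, hB'G _ _, Or.inr rfl]
  have hμx : ∀ x, (fun r => μ r x) = initMem
      (Sum.elim (fun p => Matrix.of (fun p q => A' p q x) p.1 p.2)
        (fun p => Matrix.of (fun p q => B' p q x) p.1 p.2)) := by
    intro x
    funext r
    rcases r with (p | p) | d <;> rfl
  refine ((Derives.const (G := G) (0 : F)).trans (Derives.execList P μ hμ)).mono subset_rfl ?_ ?_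
  · intro v hv
    simp only [Set.mem_iUnion, Set.mem_singleton_iff] at hv
    obtain ⟨i, hi, j, hj, rfl⟩ := hv
    refine ⟨out (f i) (k j), ?_⟩
    funext x
    dsimp only
    rw [hμx x, hout, Matrix.mul_apply, Finset.sum_apply]
    simp only [Matrix.of_apply, Pi.mul_apply]
    rw [← Finset.sum_subset (Finset.subset_univ (S.image g)), Finset.sum_image hg]
    · exact Finset.sum_congr rfl fun s hs => by rw [hA' i hi s hs, hB' s hs j hj]
    · intro q _ hq
      have hp : ¬ ∃ z : α × σ, (z.1 ∈ I ∧ f z.1 = f i) ∧ z.2 ∈ S ∧ g z.2 = q := by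
        rintro ⟨z, _, hz, hz'⟩
        exact hq (Finset.mem_image.2 ⟨z.2, hz, hz'⟩)
      simp only [A', dif_neg hp, Pi.zero_apply, zero_mul]
  · have h_one : (1 : ℝ) ≤ (b : ℝ) ^ ω :=
      Real.one_le_rpow (by exact_mod_cast Nat.one_le_iff_ne_zero.2 hb) (by linarith [h.two_le])
    nlinarith

/-- The number of blocks of size `b` in a set of at least `b` elements. -/
theorem exists_block_count {a b : ℕ} (hb : b ≠ 0) (hab : b ≤ a) :
    ∃ q : ℕ, a ≤ q * b ∧ q * b ≤ 2 * a := by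
  refine ⟨a / b + 1, ?_, ?_⟩
  · have := Nat.lt_div_mul_add (a := a) (Nat.pos_of_ne_zero hb)
    rw [add_mul]
    omega
  · have := Nat.div_mul_le_self a b
    rw [add_mul]
    omega

/-- Subtracting the product of two matrices from a matrix. -/
theorem MatMulExponent.derives_sub_mul {ω C₀ : ℝ} (h : MatMulExponent F ω C₀) {α σ κ : Type*}
    (I : Finset α) (S : Finset σ) (C : Finset κ) (n : ℕ) (hI : I.card ≤ n)
    (hS : S.card ≤ n) (hC : S.card ≤ C.card) {G : Set (Ω → F)} (V : α → κ → Ω → F)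
    (A : α → σ → Ω → F) (B : σ → κ → Ω → F) (hV : ∀ i ∈ I, ∀ j ∈ C, V i j ∈ G)
    (hA : ∀ i ∈ I, ∀ s ∈ S, A i s ∈ G) (hB : ∀ s ∈ S, ∀ j ∈ C, B s j ∈ G) :
    Derives ι G {v | ∃ i ∈ I, ∃ j ∈ C, V i j - ∑ s ∈ S, A i s * B s j = v}
      (n * C.card * (4 * (C₀ + 1) * (S.card : ℝ) ^ (ω - 2) + 1)) := by
  have h_C₀ := h.one_le
  rcases Nat.eq_zero_or_pos S.card with hS₀ | hS₀
  · obtain rfl := Finset.card_eq_zero.1 hS₀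
    refine (Derives.of_subset (G := G) ?_).mono subset_rfl subset_rfl (by positivity)
    rintro v ⟨i, hi, j, hj, rfl⟩
    simpa using hV i hi j hj
  -- Rows and columns are cut into p and q blocks of side s = |S|. From p s ≤ 2n and q s ≤ 2|C| the
  -- products cost p q (C₀+1) s^ω ≤ 4 n |C| (C₀+1) s^(ω-2); each subtraction adds 1 per entry.
  · obtain ⟨p, hp, hp'⟩ := exists_block_count hS₀.ne' hS
    obtain ⟨q, hq, hq'⟩ := exists_block_count hS₀.ne' hC
    have h_prod : Derives ι G (⋃ i ∈ I, ⋃ j ∈ C, {∑ s ∈ S, A i s * B s j})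
        (p * (q * ((C₀ + 1) * (S.card : ℝ) ^ ω))) := by
      refine Derives.of_blocks _ S.card p I (hI.trans hp) fun I' hI' hIc => ?_
      have h_block := Derives.of_blocks (ι := ι) (G := G)
        (fun j => ⋃ i ∈ I', {∑ s ∈ S, A i s * B s j}) S.card q C hq fun C' hC' hCc =>
          (h.derives_small I' S C' S.card hS₀.ne' hIc le_rfl hCc A B
            (fun i hi => hA i (hI' hi)) (fun s hs j hj => hB s hs j (hC' hj))).mono
            subset_rfl (Set.iUnion₂_comm _).subset le_rfl
      exact h_block.mono subset_rfl (Set.iUnion₂_comm _).subset le_rfl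
    have h_sub := h_prod.trans ((Derives.range (I ×ˢ C) (f := fun z : α × κ =>
      V z.1 z.2 - ∑ s ∈ S, A z.1 s * B s z.2) (n := 1)) fun z hz => by
        obtain ⟨hi, hj⟩ := Finset.mem_product.1 hz
        refine Derives.sub (Or.inl (hV _ hi _ hj)) (Or.inr ?_)
        simp only [Set.mem_iUnion]
        exact ⟨z.1, hi, z.2, hj, rfl⟩)
    refine h_sub.mono subset_rfl ?_ ?_
    · rintro v ⟨i, hi, j, hj, rfl⟩
      exact ⟨(i, j), Finset.mem_product.2 ⟨hi, hj⟩, rfl⟩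
    · have hb : (0 : ℝ) < S.card := by exact_mod_cast hS₀
      have h_rpow : (S.card : ℝ) ^ ω = S.card * S.card * (S.card : ℝ) ^ (ω - 2) := by
        rw [Real.rpow_sub hb]
        have : (0 : ℝ) < (S.card : ℝ) ^ (2 : ℝ) := Real.rpow_pos_of_pos hb 2
        field_simp
        norm_num
      have hpR : (p : ℝ) * S.card ≤ 2 * n := by exact_mod_cast hp'
      have hqR : (q : ℝ) * S.card ≤ 2 * C.card := by exact_mod_cast hq'
      have h_pq : (p : ℝ) * S.card * (q * S.card) ≤ 2 * n * (2 * C.card) :=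
        mul_le_mul hpR hqR (by positivity) (by positivity)
      have h_nonneg : 0 ≤ (C₀ + 1) * (S.card : ℝ) ^ (ω - 2) := by positivity
      have h_main := mul_le_mul_of_nonneg_right h_pq h_nonneg
      have h_card : (I.card : ℝ) * C.card ≤ n * C.card := by gcongr
      rw [Finset.card_product, h_rpow]
      push_cast
      linarith

end MatrixProduct

open Submodule

/-! ### Greedy row bases in reduced form -/

section RowBasis

open Classical in
/-- The rows in `S` are a greedy basis, with respect to the weight `w`, of the rows of `V` listed
in `l`, and `Z` is a basis of the same row space in reduced form with pivot columns `σ`. -/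
structure RowBasis {F ρ κ : Type*} [Field F] (w : ρ → ℕ) (l : List ρ) (V : ρ → κ → F)
    (S : Finset ρ) (σ : ρ → κ) (Z : ρ → κ → F) : Prop where
  mem_list : ∀ s ∈ S, s ∈ l
  pivot : ∀ s ∈ S, ∀ s' ∈ S, Z s (σ s') = if s = s' then 1 else 0
  row_mem : ∀ r ∈ l, V r ∈ span F (Z '' S)
  basis_mem : ∀ s ∈ S, Z s ∈ span F (V '' {r | r ∈ l})
  greedy : ∀ r ∈ l, V r ∈ span F (V '' {s | s ∈ S ∧ w s ≤ w r})
  ne_zero : ∀ s ∈ S, V s ≠ 0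

variable {F ρ κ : Type*} [Field F] {w : ρ → ℕ} {l : List ρ} {V : ρ → κ → F} {S : Finset ρ}
  {σ : ρ → κ} {Z : ρ → κ → F}

/-- In reduced form the coefficient at `Z s` can be read off in the pivot column `σ s`; by linearity
this only has to be checked on the basis rows. -/
theorem RowBasis.expand (h : RowBasis w l V S σ Z) {v : κ → F} (hv : v ∈ span F (Z '' S)) :
    v = ∑ s ∈ S, v (σ s) • Z s := by
  classical
  induction hv using span_induction with
  | mem v hv =>
    obtain ⟨s, hs, rfl⟩ := hv
    rw [Finset.sum_eq_single s]
    · simp [h.pivot s hs s hs]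
    · intro s' hs' hne
      simp [h.pivot s hs s' hs', hne.symm]
    · exact fun hs' => absurd hs hs'
  | zero => simp
  | add u v _ _ hu hv =>
    conv_lhs => rw [hu, hv]
    simp only [Pi.add_apply, add_smul, Finset.sum_add_distrib]
  | smul a v _ hv =>
    conv_lhs => rw [hv]
    simp only [Pi.smul_apply, Finset.smul_sum, smul_eq_mul, mul_smul]

theorem RowBasis.injOn (h : RowBasis w l V S σ Z) : Set.InjOn σ S := by
  classical
  intro s hs s' hs' hss
  have h₁ := h.pivot s hs s hs
  rw [hss, h.pivot s hs s' hs'] at h₁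
  by_contra hne
  simp [hne] at h₁

theorem RowBasis.card_le [Fintype κ] (h : RowBasis w l V S σ Z) : S.card ≤ Fintype.card κ := by
  classical
  exact Finset.card_le_card_of_injOn σ (fun s _ => Finset.mem_coe.2 (Finset.mem_univ _)) h.injOn

theorem RowBasis.nil : RowBasis w [] V ∅ σ Z := by
  constructor <;> simp

theorem RowBasis.singleton_zero {r : ρ} (hr : V r = 0) : RowBasis w [r] V ∅ σ Z := by
  constructor <;> simp [hr]

theorem RowBasis.singleton {r : ρ} {c : κ} (hr : V r c ≠ 0) :
    RowBasis w [r] V {r} (fun _ => c) (fun s j => V s j / V s c) := by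
  have h_smul : (fun j => V r j / V r c) = (V r c)⁻¹ • V r := by
    funext j
    simp [div_eq_inv_mul]
  have h_inv : V r = V r c • fun j => V r j / V r c := by
    funext j
    simp only [Pi.smul_apply, smul_eq_mul]
    field_simp
  constructor
  · simp
  · simp [hr]
  · simp only [List.mem_singleton, forall_eq, Finset.coe_singleton, Set.image_singleton]
    exact mem_span_singleton.2 ⟨V r c, h_inv.symm⟩
  · simp only [Finset.mem_singleton, forall_eq, List.mem_singleton, Set.ofPred_eq_eq_singleton,
      Set.image_singleton]
    exact mem_span_singleton.2 ⟨_, h_smul.symm⟩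
  · simp only [List.mem_singleton, forall_eq]
    exact subset_span ⟨r, by simp, rfl⟩
  · simp only [Finset.mem_singleton, forall_eq]
    exact fun h => hr (by simp [h])

open Classical in
/-- Row bases of two lists of rows are combined after the second has been reduced by the first. -/
theorem RowBasis.append {l' : List ρ} {S' : Finset ρ} {σ' : ρ → κ} {Z' : ρ → κ → F}
    (h : RowBasis w l V S σ Z)
    (h' : RowBasis w l' (fun r j => V r j - ∑ s ∈ S, V r (σ s) * Z s j) S' σ' Z')
    (hw : ∀ r ∈ l, ∀ r' ∈ l', w r ≤ w r') (hl : ∀ r ∈ l, r ∉ l') :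
    RowBasis w (l ++ l') V (S ∪ S') (fun s => if s ∈ S then σ s else σ' s)
      (fun s => if s ∈ S then fun j => Z s j - ∑ s' ∈ S', Z s (σ' s') * Z' s' j else Z' s) := by
  set V' : ρ → κ → F := fun r j => V r j - ∑ s ∈ S, V r (σ s) * Z s j with hV'
  have hV'_eq : ∀ r, V' r = V r - ∑ s ∈ S, V r (σ s) • Z s := by
    intro r
    funext j
    simp [V']
  set Y : ρ → κ → F := fun s =>
    if s ∈ S then fun j => Z s j - ∑ s' ∈ S', Z s (σ' s') * Z' s' j else Z' s with hY
  -- Back substitution: the old basis rows are cleared in the new pivot columns.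
  have hY₁ : ∀ s ∈ S, Y s = Z s - ∑ s' ∈ S', Z s (σ' s') • Z' s' := by
    intro s hs
    funext j
    simp [Y, hs]
  have hS' : ∀ s ∈ S', s ∉ S := fun s hs hs' => hl s (h.mem_list s hs') (h'.mem_list s hs)
  have hY₂ : ∀ s ∈ S', Y s = Z' s := fun s hs => by simp [Y, hS' s hs]
  -- The reduced rows vanish in the old pivot columns, hence so does everything in their span.
  have hZ'_zero : ∀ s' ∈ S', ∀ s ∈ S, Z' s' (σ s) = 0 := by
    intro s' hs' s hs
    have : span F (V' '' {r | r ∈ l'}) ≤ LinearMap.ker (LinearMap.proj (R := F) (σ s)) := by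
      rw [span_le]
      rintro _ ⟨r, _, rfl⟩
      simp only [SetLike.mem_coe, LinearMap.mem_ker, LinearMap.proj_apply, V']
      rw [Finset.sum_eq_single s]
      · simp [h.pivot s hs s hs]
      · intro t ht hts
        simp [h.pivot t ht s hs, hts]
      · exact fun hs' => absurd hs hs'
    exact this (h'.basis_mem s' hs')
  have hZ'_mem : ∀ s ∈ S', Z' s ∈ span F (Y '' ↑(S ∪ S')) := by
    intro s hs
    rw [← hY₂ s hs]
    exact subset_span ⟨s, by simp [hs], rfl⟩
  have hZ_mem : ∀ s ∈ S, Z s ∈ span F (Y '' ↑(S ∪ S')) := by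
    intro s hs
    have : Z s = Y s + ∑ s' ∈ S', Z s (σ' s') • Z' s' := by rw [hY₁ s hs]; abel
    rw [this]
    exact add_mem (subset_span ⟨s, by simp [hs], rfl⟩)
      (sum_mem fun s' hs' => smul_mem _ _ (hZ'_mem s' hs'))
  have hV_of : ∀ {W : Submodule F (κ → F)} (r : ρ), (∀ s ∈ S, Z s ∈ W) → V' r ∈ W → V r ∈ W := by
    intro W r hZ hr
    have : V r = V' r + ∑ s ∈ S, V r (σ s) • Z s := by rw [hV'_eq]; abel
    rw [this]
    exact add_mem hr (sum_mem fun s hs => smul_mem _ _ (hZ s hs))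
  have hV'_of : ∀ {W : Submodule F (κ → F)} (r : ρ), (∀ s ∈ S, Z s ∈ W) → V r ∈ W → V' r ∈ W := by
    intro W r hZ hr
    rw [hV'_eq]
    exact sub_mem hr (sum_mem fun s hs => smul_mem _ _ (hZ s hs))
  have hZ_span : ∀ s ∈ S, Z s ∈ span F (V '' {r | r ∈ l ++ l'}) := fun s hs =>
    span_mono (Set.image_mono fun r (hr : r ∈ l) => List.mem_append_left l' hr) (h.basis_mem s hs)
  have hZ'_span : ∀ s ∈ S', Z' s ∈ span F (V '' {r | r ∈ l ++ l'}) := by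
    intro s hs
    refine span_le.2 ?_ (h'.basis_mem s hs)
    rintro _ ⟨r, hr, rfl⟩
    exact hV'_of r hZ_span (subset_span ⟨r, List.mem_append_right l hr, rfl⟩)
  have h_mono : ∀ {A B : Finset ρ} {p q : ℕ}, A ⊆ B → p ≤ q →
      span F (V '' {s | s ∈ A ∧ w s ≤ p}) ≤ span F (V '' {s | s ∈ B ∧ w s ≤ q}) :=
    fun hAB hpq => span_mono (Set.image_mono fun s hs => And.intro (hAB hs.1) (hs.2.trans hpq))
  constructor
  · intro s hs
    rcases Finset.mem_union.1 hs with hs | hs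
    · exact List.mem_append_left _ (h.mem_list s hs)
    · exact List.mem_append_right _ (h'.mem_list s hs)
  · intro s hs s' hs'
    rcases Finset.mem_union.1 hs with hs | hs <;> rcases Finset.mem_union.1 hs' with hs' | hs'
    · rw [hY₁ s hs]
      simp only [hs', if_true, Pi.sub_apply, Finset.sum_apply, Pi.smul_apply, smul_eq_mul]
      rw [Finset.sum_eq_zero fun t ht => by rw [hZ'_zero t ht s' hs', mul_zero],
        h.pivot s hs s' hs', sub_zero]
    · rw [hY₁ s hs]
      simp only [hS' s' hs', if_false, Pi.sub_apply, Finset.sum_apply, Pi.smul_apply, smul_eq_mul]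
      rw [Finset.sum_eq_single s', h'.pivot s' hs' s' hs', if_pos rfl, mul_one, sub_self, if_neg]
      · rintro rfl
        exact hS' s hs' hs
      · intro t ht hts
        simp [h'.pivot t ht s' hs', hts]
      · exact fun h => absurd hs' h
    · rw [hY₂ s hs, if_pos hs', hZ'_zero s hs s' hs', if_neg]
      rintro rfl
      exact hS' s hs hs'
    · rw [hY₂ s hs, if_neg (hS' s' hs'), h'.pivot s hs s' hs']
  · intro r hr
    rcases List.mem_append.1 hr with hr | hr
    · refine span_le.2 ?_ (h.row_mem r hr)
      rintro _ ⟨s, hs, rfl⟩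
      exact hZ_mem s hs
    · refine hV_of r hZ_mem (span_le.2 ?_ (h'.row_mem r hr))
      rintro _ ⟨s, hs, rfl⟩
      exact hZ'_mem s hs
  · intro s hs
    rcases Finset.mem_union.1 hs with hs | hs
    · rw [hY₁ s hs]
      exact sub_mem (hZ_span s hs) (sum_mem fun s' hs' => smul_mem _ _ (hZ'_span s' hs'))
    · rw [hY₂ s hs]
      exact hZ'_span s hs
  · intro r hr
    rcases List.mem_append.1 hr with hr | hr
    · exact h_mono (fun s hs => Finset.mem_union_left _ hs) le_rfl (h.greedy r hr)
    -- All rows of `l` weigh at most `w r`, so their whole span is available at this weight; modulo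
    -- it, rows and reduced rows agree, which transfers the greedy property of the second half.
    · have h_top : ∀ s ∈ S, Z s ∈ span F (V '' {s | s ∈ S ∪ S' ∧ w s ≤ w r}) := by
        intro s hs
        refine span_le.2 ?_ (h.basis_mem s hs)
        rintro _ ⟨t, ht, rfl⟩
        exact h_mono (fun s hs => Finset.mem_union_left _ hs) (hw t ht r hr) (h.greedy t ht)
      refine hV_of r h_top (span_le.2 ?_ (h'.greedy r hr))
      rintro _ ⟨s, hs, rfl⟩
      exact hV'_of s h_top (subset_span ⟨s, ⟨Finset.mem_union_right _ hs.1, hs.2⟩, rfl⟩)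
  · intro s hs
    rcases Finset.mem_union.1 hs with hs | hs
    · exact h.ne_zero s hs
    · intro h₀
      refine h'.ne_zero s hs ?_
      funext j
      simp [V', h₀]

end RowBasis

/-! ### Elimination with fast matrix multiplication -/

section Elimination

variable {F : Type u} [Field F] {ι : Type v} {β : Type v} {Ω : Type*}

/-- Elimination by repeated halving of the list of rows. -/
theorem MatMulExponent.feasible_rowBasis [Nonempty β] {ω C₀ : ℝ} (h : MatMulExponent F ω C₀)
    {ρ κ : Type*} [Fintype κ] [Nonempty κ] (w : ρ → ℕ) (n : ℕ) (l : List ρ) (hn : l.length ≤ 2 ^ n)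
    (hl : l.Nodup) (hw : l.Pairwise fun r r' => w r ≤ w r') (V : ρ → κ → Ω → F)
    {D : Set Ω} {G : Set (Ω → F)} {c : ℝ} {Q : Ω → β → Prop} (hV : ∀ r ∈ l, ∀ j, V r j ∈ G)
    (H : ∀ (S : Finset ρ) (σ : ρ → κ) (Z : ρ → κ → Ω → F) (D' : Set Ω) (G' : Set (Ω → F)),
      D' ⊆ D → G ⊆ G' → (∀ s ∈ S, ∀ j, Z s j ∈ G') →
      (∀ x ∈ D', RowBasis w l (fun r j => V r j x) S σ (fun r j => Z r j x)) →
      Feasible ι D' G' c Q) :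
    Feasible ι D G (c + l.length * Fintype.card κ *
      (8 * (C₀ + 1) * (Fintype.card κ : ℝ) ^ (ω - 2) + 2) * (n + 1)) Q := by
  classical
  have h_C₀ := h.one_le
  have h_ω := h.two_le
  set d := Fintype.card κ with hd
  induction n generalizing l V D G c with
  | zero =>
    have h_cost : c ≤ c + l.length * d * (8 * (C₀ + 1) * (d : ℝ) ^ (ω - 2) + 2) * ((0 : ℕ) + 1) := by
      have : 0 ≤ l.length * d * (8 * (C₀ + 1) * (d : ℝ) ^ (ω - 2) + 2) * (((0 : ℕ) : ℝ) + 1) := by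
        positivity
      linarith
    rcases l with _ | ⟨r, _ | ⟨r', l⟩⟩
    · exact (H ∅ (fun _ => Classical.arbitrary κ) (fun _ _ => 0) D G subset_rfl subset_rfl
        (by simp) fun x _ => RowBasis.nil).mono subset_rfl subset_rfl h_cost
    -- A single row: at most d zero tests find a pivot and d divisions normalise the row, which
    -- accounts for the summand 2.
    · have h_find := Feasible.find (ι := ι) (G := G) (c := c + d) (Q := Q) (V r)
        (Finset.univ : Finset κ).toList (fun j _ => hV r (by simp) j) D
        ((H ∅ (fun _ => Classical.arbitrary κ) (fun _ _ => 0) _ G (fun x hx => hx.1) subset_rfl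
          (by simp) fun x hx => RowBasis.singleton_zero (by
            funext j
            exact hx.2 j (by simp))).mono subset_rfl subset_rfl (by simp))
        (fun j₀ _ => by
          have h_div : Derives ι G {g | ∃ j ∈ (Finset.univ : Finset κ), V r j / V r j₀ = g}
              ((Finset.univ : Finset κ).card * 1) :=
            Derives.range _ fun j _ => Derives.div (hV r (by simp) j) (hV r (by simp) j₀)
          have := h_div (D := {x ∈ D | V r j₀ x ≠ 0}) (c := c) (Q := Q) subset_rfl
            (H {r} (fun _ => j₀) (fun s j => V s j / V s j₀) _ _ (fun x hx => hx.1)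
              Set.subset_union_left (by
                intro s hs j
                obtain rfl := Finset.mem_singleton.1 hs
                exact Or.inr ⟨j, Finset.mem_univ _, rfl⟩)
              (fun x hx => RowBasis.singleton (V := fun r j => V r j x) hx.2))
          exact this.mono subset_rfl subset_rfl (by simp [Finset.card_univ, hd]))
      refine h_find.mono subset_rfl subset_rfl ?_
      simp only [Finset.length_toList, Finset.card_univ, ← hd, List.length_cons, List.length_nil]
      have : 0 ≤ d * (8 * (C₀ + 1) * (d : ℝ) ^ (ω - 2)) := by positivity
      push_cast
      linarith
    · simp only [List.length_cons, pow_zero] at hn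
      omega
  | succ n ih =>
    -- The shorter half comes first: then |S| ≤ a is at most the length of the second half, as the
    -- block products below require.
    set a := l.length / 2 with ha
    set l₁ := l.take a with hl₁
    set l₂ := l.drop a with hl₂
    have h_app : l₁ ++ l₂ = l := List.take_append_drop a l
    have h_len₁ : l₁.length = a := by simp [hl₁, ha]; omega
    have h_len₂ : l₂.length = l.length - a := by simp [hl₂]
    have h_pow : 2 ^ (n + 1) = 2 * 2 ^ n := by ring
    rw [← h_app, List.nodup_append] at hl
    rw [← h_app, List.pairwise_append] at hw
    have h_mem₁ : ∀ r ∈ l₁, r ∈ l := fun r hr => h_app ▸ List.mem_append_left l₂ hr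
    have h_mem₂ : ∀ r ∈ l₂, r ∈ l := fun r hr => h_app ▸ List.mem_append_right l₁ hr
    set K := 8 * (C₀ + 1) * (d : ℝ) ^ (ω - 2) + 2 with hK
    have h_mul : ∀ s : ℕ, s ≤ d → (l₂.length : ℝ) * d * (4 * (C₀ + 1) * (s : ℝ) ^ (ω - 2) + 1) ≤
        l₂.length * d * (K / 2) := by
      intro s hs
      have : (s : ℝ) ^ (ω - 2) ≤ (d : ℝ) ^ (ω - 2) :=
        Real.rpow_le_rpow (by positivity) (by exact_mod_cast hs) (by linarith)
      have : 4 * (C₀ + 1) * (s : ℝ) ^ (ω - 2) + 1 ≤ K / 2 := by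
        rw [hK]
        nlinarith
      gcongr
    set c₂ := c + l₂.length * d * (K / 2) with hc₂
    set c₁ := c₂ + l₂.length * d * K * (n + 1) + l₂.length * d * (K / 2) with hc₁
    refine (ih l₁ (by omega) hl.1 hw.1 V (D := D) (c := c₁)
      (fun r hr => hV r (h_mem₁ r hr)) ?_).mono subset_rfl subset_rfl ?_
    · intro S σ Z D₁ G₁ hD₁ hG₁ hZ hS
      -- One input of the branch yields the facts about S that do not depend on the input; the costs
      -- below need them.
      refine Feasible.of_nonempty fun ⟨x₁, hx₁⟩ => ?_
      have hSd : S.card ≤ d := (hS x₁ hx₁).card_le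
      have hSl : ∀ s ∈ S, s ∈ l₁ := (hS x₁ hx₁).mem_list
      have hSa : S.card ≤ l₂.length := by
        have := (Finset.card_le_card (fun s hs => List.mem_toFinset.2 (hSl s hs) :
          S ⊆ l₁.toFinset)).trans l₁.toFinset_card_le
        omega
      refine ((h.derives_sub_mul (ι := ι) l₂.toFinset S Finset.univ l₂.length l₂.toFinset_card_le
        hSa (by simpa [Finset.card_univ, hd] using hSd) V (fun r s => V r (σ s)) Z (G := G₁)
        (fun r hr j _ => hG₁ (hV r (h_mem₂ r (List.mem_toFinset.1 hr)) j))
        (fun r hr s _ => hG₁ (hV r (h_mem₂ r (List.mem_toFinset.1 hr)) _))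
        (fun s hs j _ => hZ s hs j)) subset_rfl (c := c₂ + l₂.length * d * K * (n + 1))
        ?_).mono subset_rfl subset_rfl (by
          rw [Finset.card_univ, ← hd]
          linarith [h_mul _ hSd])
      refine ih l₂ (by omega) hl.2.1 hw.2.1
        (fun r j => V r j - ∑ s ∈ S, V r (σ s) * Z s j) (fun r hr j => Or.inr
          ⟨r, List.mem_toFinset.2 hr, j, Finset.mem_univ _, rfl⟩) ?_
      intro S' σ' Z' D₂ G₂ hD₂ hG₂ hZ' hS'
      refine Feasible.of_nonempty fun ⟨x₂, hx₂⟩ => ?_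
      have hSd' : S'.card ≤ d := (hS' x₂ hx₂).card_le
      have hSa' : S'.card ≤ l₂.length :=
        (Finset.card_le_card (fun s hs => List.mem_toFinset.2 ((hS' x₂ hx₂).mem_list s hs) :
          S' ⊆ l₂.toFinset)).trans l₂.toFinset_card_le
      have hG₁₂ : G₁ ⊆ G₂ := Set.subset_union_left.trans hG₂
      refine ((h.derives_sub_mul (ι := ι) S S' Finset.univ l₂.length hSa hSa'
        (by simpa [Finset.card_univ, hd] using hSd') Z (fun s s' => Z s (σ' s')) Z' (G := G₂)
        (fun s hs j _ => hG₁₂ (hZ s hs j)) (fun s hs s' _ => hG₁₂ (hZ s hs _))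
        (fun s hs j _ => hZ' s hs j)) subset_rfl (c := c) ?_).mono subset_rfl subset_rfl (by
          rw [Finset.card_univ, ← hd]
          linarith [h_mul _ hSd'])
      refine H (S ∪ S') (fun s => if s ∈ S then σ s else σ' s)
        (fun s => if s ∈ S then fun j => Z s j - ∑ s' ∈ S', Z s (σ' s') * Z' s' j else Z' s)
        D₂ _ (hD₂.trans hD₁) ((hG₁.trans hG₁₂).trans Set.subset_union_left) ?_ ?_
      · intro s hs j
        by_cases hsS : s ∈ S
        · simp only [hsS, if_true]
          exact Or.inr ⟨s, hsS, j, Finset.mem_univ _, rfl⟩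
        · simp only [hsS, if_false]
          exact Or.inl (hZ' s ((Finset.mem_union.1 hs).resolve_left hsS) j)
      · intro x hx
        have h_comb := RowBasis.append (hS x (hD₂ hx)) (by simpa using hS' x hx) hw.2.2
          (fun r hr hr' => hl.2.2 r hr r hr' rfl)
        rw [h_app] at h_comb
        convert h_comb using 2 with s j
        by_cases hsS : s ∈ S
        · simp [hsS]
        · simp [hsS]
    · have h_sum : (l.length : ℝ) = l₁.length + l₂.length := by
        rw [← h_app, List.length_append]
        push_cast
        ring
      rw [h_sum]
      have : 0 ≤ l₁.length * d * K := by positivity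
      push_cast
      rw [hc₁, hc₂]
      linarith

end Elimination

/-! ### Coordinates of the exterior algebra -/

section Exterior

variable {R κ : Type*} [CommRing R] [LinearOrder κ]

/-- Left multiplication by a vector in the Grassmann algebra with the coordinates indexed by
the finite subsets of `κ`. -/
def extMul : (κ → R) →ₗ[R] Module.End R (Finset κ → R) :=
  LinearMap.mk₂ R
    (fun v W S => ∑ r ∈ S, (-1) ^ (S.filter (· < r)).card * v r * W (S.erase r))
    (fun v v' W => by
      funext S
      simp only [Pi.add_apply, ← Finset.sum_add_distrib]
      exact Finset.sum_congr rfl fun r _ => by ring)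
    (fun a v W => by
      funext S
      simp only [Pi.smul_apply, smul_eq_mul, Finset.mul_sum]
      exact Finset.sum_congr rfl fun r _ => by ring)
    (fun v W W' => by
      funext S
      simp only [Pi.add_apply, ← Finset.sum_add_distrib]
      exact Finset.sum_congr rfl fun r _ => by ring)
    (fun a v W => by
      funext S
      simp only [Pi.smul_apply, smul_eq_mul, Finset.mul_sum]
      exact Finset.sum_congr rfl fun r _ => by ring)

theorem extMul_apply (v : κ → R) (W : Finset κ → R) (S : Finset κ) :
    extMul v W S = ∑ r ∈ S, (-1) ^ (S.filter (· < r)).card * v r * W (S.erase r) := rfl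

theorem card_filter_erase_of_lt {S : Finset κ} {a b : κ} (ha : a ∈ S) (hab : a < b) :
    ((S.erase a).filter (· < b)).card + 1 = (S.filter (· < b)).card := by
  rw [Finset.filter_erase]
  exact Finset.card_erase_add_one (by simp [ha, hab])

theorem card_filter_erase_of_not_lt {S : Finset κ} {a b : κ} (hab : ¬ a < b) :
    ((S.erase a).filter (· < b)).card = (S.filter (· < b)).card := by
  rw [Finset.filter_erase, Finset.erase_eq_of_notMem (by simp [hab])]

/-- For a < b, erasing a lowers the position of b by one, while erasing b leaves that of a
unchanged. -/
theorem extMul_sign {S : Finset κ} {a b : κ} (ha : a ∈ S) (hab : a < b) :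
    (-1 : R) ^ (S.filter (· < a)).card * (-1) ^ ((S.erase a).filter (· < b)).card =
      -((-1) ^ (S.filter (· < b)).card * (-1) ^ ((S.erase b).filter (· < a)).card) := by
  rw [card_filter_erase_of_not_lt hab.not_gt, ← card_filter_erase_of_lt ha hab]
  ring

/-- In the double sum over ordered pairs, the terms of (a, b) and (b, a) cancel by `extMul_sign`.
This relation is what the universal property of the exterior algebra asks for. -/
theorem extMul_self (v : κ → R) : extMul v * extMul v = 0 := by
  refine LinearMap.ext fun W => funext fun S => ?_
  simp only [Module.End.mul_apply, extMul_apply, Finset.mul_sum, LinearMap.zero_apply,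
    Pi.zero_apply]
  rw [Finset.sum_sigma']
  refine Finset.sum_involution (fun p _ => ⟨p.2, p.1⟩) ?_ ?_ ?_ ?_
  · rintro ⟨a, b⟩ hab
    simp only [Finset.mem_sigma, Finset.mem_erase] at hab ⊢
    obtain ⟨ha, hba, hb⟩ := hab
    rw [Finset.erase_right_comm (a := b) (b := a)]
    rcases lt_or_gt_of_ne hba with hlt | hlt
    · linear_combination (v a * v b * W ((S.erase a).erase b)) * extMul_sign (R := R) hb hlt
    · linear_combination (v a * v b * W ((S.erase a).erase b)) * extMul_sign (R := R) ha hlt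
  · rintro ⟨a, b⟩ hab _ heq
    simp only [Finset.mem_sigma, Finset.mem_erase] at hab
    simp only [Sigma.mk.injEq] at heq
    exact hab.2.1 heq.1
  · rintro ⟨a, b⟩ hab
    simp only [Finset.mem_sigma, Finset.mem_erase] at hab ⊢
    exact ⟨hab.2.2, hab.2.1.symm, hab.1⟩
  · rintro ⟨a, b⟩ _
    rfl

/-- The Grassmann coordinates of the exterior product of a list of vectors. -/
def extProd (l : List (κ → R)) : Finset κ → R :=
  (l.map extMul).prod fun S => if S = ∅ then 1 else 0

theorem extProd_nil : extProd ([] : List (κ → R)) = fun S => if S = ∅ then 1 else 0 := rfl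

theorem extProd_append (l' l : List (κ → R)) :
    extProd (l' ++ l) = (l'.map extMul).prod (extProd l) := by
  simp [extProd, List.prod_append]

theorem extProd_cons (v : κ → R) (l : List (κ → R)) :
    extProd (v :: l) = extMul v (extProd l) := by
  simp [extProd]

theorem extProd_eq_zero {l : List (κ → R)} {S : Finset κ} (h : S.card ≠ l.length) :
    extProd l S = 0 := by
  induction l generalizing S with
  | nil =>
    have : S ≠ ∅ := by simpa using h
    simp [extProd_nil, this]
  | cons v l ih =>
    rw [extProd_cons, extMul_apply]
    refine Finset.sum_eq_zero fun r hr => ?_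
    rw [ih, mul_zero]
    rw [Finset.card_erase_of_mem hr]
    have := Finset.card_pos.2 ⟨r, hr⟩
    simp only [List.length_cons] at h
    omega

theorem extProd_single [Nontrivial R] (l : List κ) (hl : l.Nodup) :
    IsUnit (extProd (l.map fun r => (Pi.single r 1 : κ → R)) l.toFinset) := by
  induction l with
  | nil => simp [extProd_nil]
  | cons r l ih =>
    rw [List.nodup_cons] at hl
    have hr : r ∉ l.toFinset := by simpa using hl.1
    rw [List.map_cons, extProd_cons, extMul_apply, List.toFinset_cons, Finset.sum_eq_single r]
    · rw [Finset.erase_insert hr, Pi.single_eq_same, mul_one]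
      exact (isUnit_one.neg.pow _).mul (ih hl.2)
    · intro s _ hs
      simp [Pi.single_eq_of_ne hs]
    · simp

/-- Over the ring Ω → R the exterior product is a quantity of the computation, over R its value on
one input. This is why the coordinates are set up over a commutative ring. -/
theorem extProd_apply_of_pi {Ω : Type*} (l : List (κ → Ω → R)) (S : Finset κ) (x : Ω) :
    extProd l S x = extProd (l.map fun v r => v r x) S := by
  induction l generalizing S with
  | nil => by_cases h : S = ∅ <;> simp [extProd_nil, h]
  | cons v l ih =>
    simp only [List.map_cons, extProd_cons, extMul_apply, Finset.sum_apply, Pi.mul_apply, ih]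
    exact Finset.sum_congr rfl fun r _ => by simp

end Exterior

/-! ### Exterior products detect independence -/

section Independence

variable {F κ : Type*} [Field F] [LinearOrder κ]

/-- The exterior product as an alternating map. -/
noncomputable def extMap (F κ : Type*) [Field F] [LinearOrder κ] (n : ℕ) :
    (κ → F) [⋀^Fin n]→ₗ[F] (Finset κ → F) :=
  (LinearMap.applyₗ (fun S : Finset κ => if S = ∅ then (1 : F) else 0) ∘ₗ
    (ExteriorAlgebra.lift F ⟨extMul, extMul_self⟩).toLinearMap).compAlternatingMap
      (ExteriorAlgebra.ιMulti F n)

theorem extMap_apply {n : ℕ} (v : Fin n → κ → F) : extMap F κ n v = extProd (List.ofFn v) := by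
  simp [extMap, extProd, ExteriorAlgebra.ιMulti_apply, map_list_prod, List.map_ofFn,
    Function.comp_def]

theorem linearIndependent_of_extProd_ne_zero {l : List (κ → F)} (h : extProd l ≠ 0) :
    LinearIndependent F l.get := by
  by_contra hli
  have := AlternatingMap.map_linearDependent (extMap F κ l.length) l.get hli
  rw [extMap_apply, List.ofFn_get] at this
  exact h this

variable [Fintype κ]

/-- The top coordinate of the exterior product as an alternating map. -/
noncomputable def extTop (F κ : Type*) [Field F] [LinearOrder κ] [Fintype κ] (n : ℕ) :
    (κ → F) [⋀^Fin n]→ₗ[F] F :=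
  (LinearMap.proj Finset.univ).compAlternatingMap (extMap F κ n)

theorem extTop_apply {n : ℕ} (v : Fin n → κ → F) :
    extTop F κ n v = extProd (List.ofFn v) Finset.univ := by
  rw [← extMap_apply]
  rfl

/-- A list of vectors of the full length is linearly independent if and only if the top
coordinate of its exterior product does not vanish. -/
theorem extProd_univ_ne_zero_iff {l : List (κ → F)} (hl : l.length = Fintype.card κ) :
    extProd l Finset.univ ≠ 0 ↔ LinearIndependent F l.get := by
  have h_top : extProd l Finset.univ = extTop F κ l.length l.get := by
    rw [extTop_apply, List.ofFn_get]
  rw [h_top]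
  constructor
  · intro h
    by_contra hli
    exact h (AlternatingMap.map_linearDependent _ _ hli)
  · intro h
    -- The top form does not vanish on the standard basis, so it vanishes on no basis.
    have h_ne : extTop F κ l.length ≠ 0 := by
      intro h₀
      have h_unit := extProd_single (R := F) (Finset.univ : Finset κ).toList
        (Finset.nodup_toList _)
      rw [Finset.toList_toFinset] at h_unit
      set l₀ := (Finset.univ : Finset κ).toList.map fun r => (Pi.single r 1 : κ → F) with hl₀
      have h_len : l₀.length = l.length := by simp [hl₀, hl]
      have h_app := extTop_apply (F := F) (κ := κ) l₀.get
      have h₁ : extTop F κ l₀.length = 0 := h_len ▸ h₀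
      rw [List.ofFn_get, h₁] at h_app
      exact h_unit.ne_zero h_app.symm
    have h_span : ⊤ ≤ span F (Set.range l.get) :=
      (h.span_eq_top_of_card_eq_finrank' (by simp [hl])).ge
    simpa using (AlternatingMap.map_basis_ne_zero_iff (Module.Basis.mk h h_span)
      (extTop F κ l.length)).2 h_ne

/-- Some exterior product among those that span a given one has the same complement. -/
theorem extProd_exchange {α : Type*} {j : ℕ} (f : α → List (κ → F)) (A : Set α) (r : α)
    (hA : ∀ s ∈ A, (f s).length = j) (hr : (f r).length = j) (l : List (κ → F))
    (hl : l.length + j = Fintype.card κ)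
    (h_span : (fun S : {S : Finset κ // S.card = j} => extProd (f r) S.1) ∈
      span F ((fun s (S : {S : Finset κ // S.card = j}) => extProd (f s) S.1) '' A))
    (h : LinearIndependent F (l ++ f r).get) : ∃ s ∈ A, LinearIndependent F (l ++ f s).get := by
  let e : ({S : Finset κ // S.card = j} → F) →ₗ[F] (Finset κ → F) :=
    { toFun := fun U S => if h : S.card = j then U ⟨S, h⟩ else 0
      map_add' := fun U U' => by
        funext S
        by_cases h : S.card = j <;> simp [h]
      map_smul' := fun a U => by
        funext S
        by_cases h : S.card = j <;> simp [h] }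
  have he : ∀ s, (f s).length = j → e (fun S => extProd (f s) S.1) = extProd (f s) := by
    intro s hs
    funext S
    by_cases h : S.card = j
    · simp [e, h]
    · simp [e, h, extProd_eq_zero (hs ▸ h)]
  -- The functional given by the complement `l`: pad the degree-j coordinates by zeros, multiply by
  -- `l`, take the top coordinate. If it vanished on all members of A, it would vanish on their
  -- span, hence at r.
  let Φ : ({S : Finset κ // S.card = j} → F) →ₗ[F] F :=
    LinearMap.proj Finset.univ ∘ₗ (l.map extMul).prod ∘ₗ e
  have hΦ : ∀ s, (f s).length = j →
      (Φ (fun S => extProd (f s) S.1) ≠ 0 ↔ LinearIndependent F (l ++ f s).get) := by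
    intro s hs
    rw [← extProd_univ_ne_zero_iff (by rw [List.length_append, hs, hl]), extProd_append]
    simp only [Φ, LinearMap.comp_apply, he s hs, LinearMap.proj_apply]
  by_contra! h_all
  refine (hΦ r hr).2 h ?_
  have h_le : span F ((fun s (S : {S : Finset κ // S.card = j}) => extProd (f s) S.1) '' A) ≤
      LinearMap.ker Φ := by
    rw [span_le]
    rintro _ ⟨s, hs, rfl⟩
    by_contra h_ne
    exact h_all s hs ((hΦ s (hA s hs)).1 h_ne)
  exact h_le h_span

end Independence

/-! ### The cost of exterior products -/

section ExteriorCost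

variable {F : Type u} [Field F] {ι : Type v} {Ω κ : Type*} [LinearOrder κ] [Fintype κ]

/-- Computing all coordinates of an exterior product by repeated multiplication with a vector. -/
theorem Derives.extProd {G : Set (Ω → F)} (l : List (κ → Ω → F)) (hl : ∀ v ∈ l, ∀ r, v r ∈ G) :
    Derives ι G (Set.range (FieldComp.extProd l))
      ((l.length + 1) * (2 ^ Fintype.card κ * (5 * Fintype.card κ + 1))) := by
  induction l with
  | nil =>
    have : Derives ι G {g | ∃ S ∈ (Finset.univ : Finset (Finset κ)),
        FieldComp.extProd ([] : List (κ → Ω → F)) S = g} ((Finset.univ : Finset (Finset κ)).card * 1) := by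
      refine Derives.range _ fun S _ => ?_
      by_cases h : S = ∅
      · simp only [extProd_nil, h, if_true]
        exact Derives.const 1
      · simp only [extProd_nil, h, if_false]
        exact Derives.const 0
    refine this.mono subset_rfl ?_ ?_
    · rintro _ ⟨S, rfl⟩
      exact ⟨S, Finset.mem_univ _, rfl⟩
    · simp only [Finset.card_univ, Fintype.card_finset, List.length_nil]
      push_cast
      have : (0 : ℝ) ≤ 2 ^ Fintype.card κ * (5 * Fintype.card κ) := by positivity
      linarith
  | cons v l ih =>
    have h_coord : ∀ S : Finset κ, Derives ι (G ∪ Set.range (FieldComp.extProd l))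
        {FieldComp.extProd (v :: l) S} (5 * Fintype.card κ + 1) := by
      intro S
      rw [extProd_cons, extMul_apply]
      refine (Derives.sum S (n := 3) fun r hr => ?_).mono subset_rfl subset_rfl ?_
      · have h₁ := Derives.const (ι := ι) (G := G ∪ Set.range (FieldComp.extProd l))
          ((-1 : F) ^ (S.filter (· < r)).card)
        have h₂ := h₁.union (Derives.mul (Or.inr rfl) (Or.inl (Or.inl (hl v (by simp) r))))
        have h₃ := h₂.trans (Derives.mul (Or.inr (Or.inr rfl))
          (Or.inl (Or.inr (Set.mem_range_self (f := FieldComp.extProd l) (S.erase r)))))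
        refine h₃.mono subset_rfl ?_ (by norm_num)
        rw [Set.singleton_subset_iff, Set.mem_singleton_iff]
        funext x
        simp
      · have : (S.card : ℝ) ≤ Fintype.card κ := by exact_mod_cast S.card_le_univ
        linarith
    have h_all := (ih fun u hu => hl u (by simp [hu])).trans
      (Derives.range Finset.univ fun S _ => h_coord S)
    refine h_all.mono subset_rfl ?_ ?_
    · rintro _ ⟨S, rfl⟩
      exact ⟨S, Finset.mem_univ _, rfl⟩
    · simp only [Finset.card_univ, Fintype.card_finset, List.length_cons]
      push_cast
      linarith

end ExteriorCost

/-! ### Contraction of an independent set by clearing pivot columns -/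

section Contraction

variable {F E V W : Type*} [Field F] [AddCommGroup V] [Module F V] [AddCommGroup W] [Module F W]

/-- Linear independence of a list of members of a family. -/
theorem linearIndependent_map_get_iff (l : List E) (g : E → V) :
    LinearIndependent F (l.map g).get ↔ l.Nodup ∧ LinearIndepOn F g {e | e ∈ l} := by
  have h_eq : LinearIndependent F (l.map g).get ↔ LinearIndependent F (g ∘ l.get) := by
    refine linearIndependent_equiv' (finCongr (List.length_map g)) ?_
    funext i
    simp
  rw [h_eq]
  constructor
  · intro h
    have h_inj : Function.Injective l.get := h.injective.of_comp
    refine ⟨List.nodup_iff_injective_get.2 h_inj, ?_⟩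
    have := (linearIndepOn_range_iff h_inj g).2 h
    rwa [Set.range_list_get] at this
  · rintro ⟨h, h'⟩
    refine (linearIndepOn_range_iff (List.nodup_iff_injective_get.1 h) g).1 ?_
    rwa [Set.range_list_get]

/-- Independence after a linear map whose kernel is spanned by an independent set. -/
theorem linearIndepOn_comp_iff_union {g : E → V} {X B : Set E} (φ : V →ₗ[F] W)
    (hφ : LinearMap.ker φ = span F (g '' X)) (hX : LinearIndepOn F g X) (hB : Disjoint X B) :
    LinearIndepOn F (φ ∘ g) B ↔ LinearIndepOn F g (X ∪ B) := by
  rw [← hX.quotient_iff_union hB]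
  let ψ : (V ⧸ span F (g '' X)) →ₗ[F] W := (span F (g '' X)).liftQ φ hφ.ge
  have hψ : LinearMap.ker ψ = ⊥ := Submodule.ker_liftQ_eq_bot _ _ _ hφ.le
  have h_comp : φ ∘ g = ψ ∘ ((span F (g '' X)).mkQ ∘ g) := by
    funext e
    simp [ψ]
  rw [h_comp, LinearMap.linearIndepOn_iff_of_injOn _ (LinearMap.ker_eq_bot.1 hψ).injOn]

variable {ρ κ : Type*} {w : ρ → ℕ} {l : List ρ} {S : Finset ρ} {σ : ρ → κ} {Z : ρ → κ → F}
  {U : ρ → κ → F}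

/-- Clearing the pivot columns of a reduced row basis, and deleting these columns. -/
def RowBasis.reduce (S : Finset ρ) (σ : ρ → κ) (Z : ρ → κ → F) (p : κ → Prop) :
    (κ → F) →ₗ[F] ({c // p c} → F) where
  toFun v c := v c - ∑ s ∈ S, v (σ s) * Z s c
  map_add' u v := by
    funext c
    simp only [Pi.add_apply, add_mul, Finset.sum_add_distrib]
    ring
  map_smul' a v := by
    funext c
    simp only [Pi.smul_apply, smul_eq_mul, mul_sub, Finset.mul_sum, RingHom.id_apply, mul_assoc]

theorem RowBasis.span_eq (h : RowBasis w l U S σ Z) :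
    span F (Z '' S) = span F (U '' {r | r ∈ l}) := by
  refine le_antisymm (span_le.2 ?_) (span_le.2 ?_)
  · rintro _ ⟨s, hs, rfl⟩
    exact h.basis_mem s hs
  · rintro _ ⟨r, hr, rfl⟩
    exact h.row_mem r hr

/-- Subtracting the expansion in the pivot columns always clears those columns, so a vector
vanishing in the others equals its expansion; conversely, `RowBasis.expand` applies to the row
space. The remaining columns therefore represent the contraction. -/
theorem RowBasis.ker_reduce (h : RowBasis w l U S σ Z) :
    LinearMap.ker (RowBasis.reduce S σ Z fun c => ∀ s ∈ S, c ≠ σ s) =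
      span F (U '' {r | r ∈ l}) := by
  classical
  rw [← h.span_eq]
  refine le_antisymm (fun v hv => ?_) (fun v hv => ?_)
  · have h_exp : v = ∑ s ∈ S, v (σ s) • Z s := by
      funext c
      rw [Finset.sum_apply]
      simp only [Pi.smul_apply, smul_eq_mul]
      by_cases hc : ∀ s ∈ S, c ≠ σ s
      · exact sub_eq_zero.1 (congrFun (LinearMap.mem_ker.1 hv) ⟨c, hc⟩)
      · push Not at hc
        obtain ⟨s, hs, rfl⟩ := hc
        rw [Finset.sum_eq_single s]
        · simp [h.pivot s hs s hs]
        · intro t ht hts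
          simp [h.pivot t ht s hs, hts]
        · exact fun hs' => absurd hs hs'
    rw [h_exp]
    exact sum_mem fun s hs => smul_mem _ _ (subset_span ⟨s, hs, rfl⟩)
  · rw [LinearMap.mem_ker]
    funext c
    have := congrFun (h.expand hv) c
    simp only [Finset.sum_apply, Pi.smul_apply, smul_eq_mul] at this
    exact sub_eq_zero.2 this

/-- `Z` spans a space of dimension the number of rows. The contraction thus keeps exactly k - |X|
columns. -/
theorem RowBasis.card_eq [DecidableEq ρ] (h : RowBasis w l U S σ Z)
    (hl : LinearIndepOn F U {r | r ∈ l}) : S.card = l.toFinset.card := by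
  classical
  refine le_antisymm (Finset.card_le_card fun s hs => List.mem_toFinset.2 (h.mem_list s hs)) ?_
  have h_fin : Set.finrank F (U '' {r | r ∈ l}) = l.toFinset.card := by
    have h_set : {r | r ∈ l} = (l.toFinset : Set ρ) := by
      ext r
      simp
    rw [h_set] at hl ⊢
    rw [Set.image_eq_range]
    exact (finrank_span_eq_card hl).trans (Fintype.card_coe l.toFinset)
  rw [← h_fin, Set.finrank, ← h.span_eq, ← Finset.coe_image]
  exact (finrank_span_finset_le_card _).trans Finset.card_image_le

end Contraction

/-! ### Representative families in a contraction -/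

section Select

variable {F : Type u} [Field F] {ι : Type v} {β : Type v} {Ω : Type*}

/-- Selecting lists of vectors whose exterior products span those of all lists given. -/
theorem MatMulExponent.feasible_select [Nonempty β] {ω C₀ : ℝ} (h : MatMulExponent F ω C₀)
    {ρ κ : Type*} [LinearOrder κ] [Fintype κ] (B : Finset ρ) (n : ℕ) (hn : B.card ≤ 2 ^ n)
    (w : ρ → ℕ) (f : ρ → List (κ → Ω → F)) (j : ℕ) (hj : j ≤ Fintype.card κ)
    (hf : ∀ r ∈ B, (f r).length = j) {D : Set Ω} {G : Set (Ω → F)} {c : ℝ} {Q : Ω → β → Prop}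
    (hG : ∀ r ∈ B, ∀ v ∈ f r, ∀ a, v a ∈ G)
    (H : ∀ S ⊆ B, S.card ≤ (Fintype.card κ).choose j → ∀ D' ⊆ D,
      (∀ x ∈ D', (∀ s ∈ S, LinearIndependent F ((f s).map fun v a => v a x).get) ∧
        ∀ r ∈ B, ∀ l : List (κ → F), l.length + j = Fintype.card κ →
          LinearIndependent F (l ++ (f r).map fun v a => v a x).get →
          ∃ s ∈ S, w s ≤ w r ∧ LinearIndependent F (l ++ (f s).map fun v a => v a x).get) →
      Feasible ι D' G c Q) :
    Feasible ι D G (c + (B.card * ((j + 1) * (2 ^ Fintype.card κ * (5 * Fintype.card κ + 1))) +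
      B.card * (Fintype.card κ).choose j *
        (8 * (C₀ + 1) * ((Fintype.card κ).choose j : ℝ) ^ (ω - 2) + 2) * (n + 1))) Q := by
  classical
  -- Comparing weights is combinatorial work and costs no field operation; the order makes the
  -- greedy basis one of minimum weight.
  set l : List ρ := B.toList.mergeSort fun r r' => decide (w r ≤ w r') with hl
  have h_perm : l.Perm B.toList := List.mergeSort_perm _ _
  have h_mem : ∀ r, r ∈ l ↔ r ∈ B := fun r => by rw [h_perm.mem_iff, Finset.mem_toList]
  have h_nodup : l.Nodup := h_perm.nodup_iff.2 B.nodup_toList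
  have h_len : l.length = B.card := by rw [h_perm.length_eq, Finset.length_toList]
  have h_sorted : l.Pairwise fun r r' => w r ≤ w r' := by
    have := List.pairwise_mergeSort (le := fun r r' => decide (w r ≤ w r'))
      (fun a b c hab hbc => by simp only [decide_eq_true_eq] at *; omega)
      (fun a b => by simp only [Bool.or_eq_true, decide_eq_true_eq]; omega) B.toList
    exact this.imp fun h => by simpa using h
  have h_card : Fintype.card {S : Finset κ // S.card = j} = (Fintype.card κ).choose j :=
    Fintype.card_finset_len j
  have h_ne : Nonempty {S : Finset κ // S.card = j} := by
    rw [← Fintype.card_pos_iff, h_card]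
    exact Nat.choose_pos hj
  have h_ext : Derives ι G (⋃ r ∈ B, Set.range (extProd (f r)))
      (∑ r ∈ B, (j + 1) * (2 ^ Fintype.card κ * (5 * Fintype.card κ + 1))) :=
    Derives.biUnion B fun r hr => by
      have := Derives.extProd (ι := ι) (f r) (hG r hr)
      rwa [hf r hr] at this
  have h_elim := h.feasible_rowBasis (ι := ι) (D := D) (c := c) (Q := Q)
    (G := G ∪ ⋃ r ∈ B, Set.range (extProd (f r))) w n l (h_len ▸ hn) h_nodup h_sorted
    (fun r (S : {S : Finset κ // S.card = j}) => extProd (f r) S.1)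
    (fun r hr S => Or.inr (Set.mem_biUnion ((h_mem r).1 hr) ⟨S.1, rfl⟩)) (by
      intro S σ Z D' G' hD' hG' _ hS
      refine Feasible.of_nonempty fun ⟨x₀, hx₀⟩ => ?_
      have h_sub : S ⊆ B := fun s hs => (h_mem s).1 ((hS x₀ hx₀).mem_list s hs)
      refine (H S h_sub (h_card ▸ (hS x₀ hx₀).card_le) D' hD' fun x hx => ⟨fun s hs => ?_, ?_⟩).mono
        subset_rfl (Set.subset_union_left.trans hG') le_rfl
      · refine linearIndependent_of_extProd_ne_zero fun h₀ => (hS x hx).ne_zero s hs ?_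
        funext T
        simpa [extProd_apply_of_pi] using congrFun h₀ T.1
      · intro r hr l' hl' h_ind
        obtain ⟨s, hs, hs'⟩ := extProd_exchange (fun r => (f r).map fun v a => v a x)
          {s | s ∈ S ∧ w s ≤ w r} r (fun s hs => by simpa using hf s (h_sub hs.1))
          (by simpa using hf r hr) l' hl' (by
            have := (hS x hx).greedy r ((h_mem r).2 hr)
            simpa only [extProd_apply_of_pi] using this) h_ind
        exact ⟨s, hs.1, hs.2, hs'⟩)
  refine (h_ext subset_rfl h_elim).mono subset_rfl subset_rfl ?_
  rw [h_card, h_len, Finset.sum_const, nsmul_eq_mul]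
  linarith

/-- The members of `S` represent those of `B` after the contraction of `X`, with respect to
complements of `q` elements. -/
def ContractRep {F E V : Type*} [Field F] [AddCommGroup V] [Module F V] [DecidableEq E]
    (g : E → V) (X : Finset E) (q : ℕ) (w : Finset E → ℕ) (S B : Finset (Finset E)) : Prop :=
  (∀ Y ∈ S, LinearIndepOn F g (X ∪ Y : Finset E)) ∧
    ∀ Y ∈ B, ∀ Y₁ : Finset E, Y₁.card = q → Disjoint Y Y₁ → Disjoint X Y₁ →
      LinearIndepOn F g (X ∪ (Y ∪ Y₁) : Finset E) →
      ∃ Y' ∈ S, Disjoint Y' Y₁ ∧ LinearIndepOn F g (X ∪ (Y' ∪ Y₁) : Finset E) ∧ w Y' ≤ w Y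

/-- Finding a representative subfamily after the contraction of an independent set. -/
theorem MatMulExponent.feasible_contractRep [Nonempty β] {ω C₀ : ℝ} (h : MatMulExponent F ω C₀)
    {E : Type*} [DecidableEq E] {k : ℕ} (hk : k ≠ 0) (a : E → Fin k → Ω → F) (X : Finset E) (j : ℕ)
    (hj : X.card + j ≤ k) (B : Finset (Finset E)) (hBj : ∀ Y ∈ B, Y.card = j)
    (hBX : ∀ Y ∈ B, Disjoint X Y) (w : Finset E → ℕ) (n : ℕ) (hn : B.card ≤ 2 ^ n)
    {D : Set Ω} {G : Set (Ω → F)} {c : ℝ} {Q : Ω → β → Prop} (hG : ∀ e r, a e r ∈ G)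
    (hD : ∀ x ∈ D, LinearIndepOn F (fun e r => a e r x) X)
    (H : ∀ S ⊆ B, S.card ≤ (k - X.card).choose j → ∀ D' ⊆ D,
      (∀ x ∈ D', ContractRep (F := F) (fun e r => a e r x) X (k - X.card - j) w S B) →
      Feasible ι D' G c Q) :
    Feasible ι D G (c + (X.card * k * (8 * (C₀ + 1) * (k : ℝ) ^ (ω - 2) + 2) * (X.card + 1) +
      (B.card * (j * ((k - X.card : ℕ) * (2 * X.card + 2))) +
      (B.card * ((j + 1) * (2 ^ (k - X.card) * (5 * (k - X.card : ℕ) + 1))) +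
      B.card * (k - X.card).choose j *
        (8 * (C₀ + 1) * ((k - X.card).choose j : ℝ) ^ (ω - 2) + 2) * (n + 1))))) Q := by
  classical
  have : Nonempty (Fin k) := ⟨⟨0, Nat.pos_of_ne_zero hk⟩⟩
  set i := X.card with hi
  set c₁ := B.card * ((j + 1) * (2 ^ (k - i) * (5 * (k - i : ℕ) + 1))) +
      B.card * (k - i).choose j *
        (8 * (C₀ + 1) * ((k - i).choose j : ℝ) ^ (ω - 2) + 2) * (n + 1) with hc₁
  set c₂ : ℝ := B.card * (j * ((k - i : ℕ) * (2 * i + 2))) with hc₂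
  -- The rows are the vectors of X. Their order is irrelevant, so the weight is constant, and the
  -- crude depth i is enough since i ≤ 2^i.
  refine (h.feasible_rowBasis (ι := ι) (D := D) (G := G) (c := c + c₁ + c₂) (Q := Q)
    (fun _ => 0) i X.toList (by
      rw [Finset.length_toList]
      exact Nat.lt_two_pow_self.le) X.nodup_toList (List.pairwise_of_forall fun _ _ => le_rfl) a
    (fun e _ r => hG e r) ?_).mono subset_rfl subset_rfl (by
      rw [Finset.length_toList, Fintype.card_fin]
      linarith)
  intro S σ Z D₁ G₁ hD₁ hG₁ hZ hS
  refine Feasible.of_nonempty fun ⟨x₁, hx₁⟩ => ?_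
  have h_set : {e | e ∈ X.toList} = (X : Set E) := by
    ext e
    simp
  have hSc : S.card = i := by
    have := (hS x₁ hx₁).card_eq (h_set ▸ hD x₁ (hD₁ hx₁))
    rwa [Finset.toList_toFinset] at this
  set p : Fin k → Prop := fun r => ∀ s ∈ S, r ≠ σ s with hp
  have h_card : Fintype.card {r // p r} = k - i := by
    have h₁ : Fintype.card {r // p r} = (S.image σ)ᶜ.card := by
      rw [Fintype.card_subtype]
      congr 1
      ext r
      simp only [hp, Finset.mem_filter, Finset.mem_univ, true_and, Finset.mem_compl,
        Finset.mem_image, not_exists, not_and]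
      exact ⟨fun h s hs hr => h s hs hr.symm, fun h s hs hr => h s hs hr.symm⟩
    rw [h₁, Finset.card_compl, Finset.card_image_of_injOn (hS x₁ hx₁).injOn, hSc, Fintype.card_fin]
  set b : E → {r // p r} → Ω → F := fun e r => a e r - ∑ s ∈ S, a e (σ s) * Z s r with hb
  have hbx : ∀ x, (fun (e : E) (r : {r // p r}) => b e r x) =
      RowBasis.reduce S σ (fun s r => Z s r x) p ∘ fun e r => a e r x := by
    intro x
    funext e r
    simp [b, RowBasis.reduce]
  -- Vectors are reduced anew for each member of B, so that the cost depends on |B| and not on |E|.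
  -- An entry takes 2i + 1 operations for the sum and one subtraction.
  have h_reduce : Derives ι G₁ (⋃ Y ∈ B, {g | ∃ z ∈ Y ×ˢ (Finset.univ : Finset {r // p r}),
      b z.1 z.2 = g}) (∑ Y ∈ B, j * ((k - i : ℕ) * (2 * i + 2))) := by
    refine Derives.biUnion B fun Y hY => ?_
    refine (Derives.range (Y ×ˢ (Finset.univ : Finset {r // p r})) (f := fun z => b z.1 z.2)
      (n := 2 * i + 2) fun z _ => ?_).mono subset_rfl subset_rfl ?_
    · have h_sum := Derives.sum (ι := ι) (G := G₁) S (f := fun s => a z.1 (σ s) * Z s z.2) (n := 1)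
        fun s hs => Derives.mul (hG₁ (hG _ _)) (hZ s hs _)
      refine (h_sum.trans (Derives.sub (f := a z.1 z.2) (Or.inl (hG₁ (hG _ _)))
        (Or.inr rfl))).mono subset_rfl subset_rfl ?_
      rw [hSc]
      linarith
    · rw [Finset.card_product, Finset.card_univ, h_card, hBj Y hY]
      push_cast
      linarith
  refine (h_reduce (c := c + c₁) subset_rfl ?_).mono subset_rfl subset_rfl (by
    rw [Finset.sum_const, nsmul_eq_mul])
  have h_select := h.feasible_select (ι := ι) (D := D₁) (c := c) (Q := Q)
    (G := G₁ ∪ ⋃ Y ∈ B, {g | ∃ z ∈ Y ×ˢ (Finset.univ : Finset {r // p r}), b z.1 z.2 = g})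
    B n hn w (fun Y => Y.toList.map b) j (by omega) (fun Y hY => by simpa using hBj Y hY) (by
      intro Y hY v hv r
      obtain ⟨e, he, rfl⟩ := List.mem_map.1 hv
      exact Or.inr (Set.mem_biUnion hY ⟨(e, r), by simpa using he, rfl⟩)) (by
      intro T hTB hTc D₂ hD₂ hT
      rw [h_card] at hTc hT
      refine (H T hTB hTc D₂ (hD₂.trans hD₁) fun x hx => ?_).mono subset_rfl
        (hG₁.trans Set.subset_union_left) le_rfl
      set g : E → Fin k → F := fun e r => a e r x with hg
      set φ := RowBasis.reduce S σ (fun s r => Z s r x) p with hφ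
      have hφX : LinearMap.ker φ = span F (g '' X) := by
        rw [← h_set]
        exact (hS x (hD₂ hx)).ker_reduce
      have h_map : ∀ l : List E, (l.map b).map (fun v r => v r x) = l.map (φ ∘ g) := by
        intro l
        rw [List.map_map, ← hbx x]
        rfl
      have h_iff := fun {C : Finset E} (hC : Disjoint X C) =>
        linearIndepOn_comp_iff_union (B := (C : Set E)) φ hφX (hD x (hD₁ (hD₂ hx)))
          (Finset.disjoint_coe.2 hC)
      obtain ⟨hT₁, hT₂⟩ := hT x hx
      refine ⟨fun Y hY => ?_, fun Y hY Y₁ hY₁ hYY₁ hXY₁ h_ind => ?_⟩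
      · have h_get := hT₁ Y hY
        rw [h_map] at h_get
        have := ((linearIndependent_map_get_iff _ _).1 h_get).2
        have h_coe : {e | e ∈ Y.toList} = (Y : Set E) := by
          ext e
          simp
        rw [h_coe, h_iff (hBX Y (hTB hY))] at this
        rwa [Finset.coe_union]
      · have h_coe : ∀ C : Finset E, {e | e ∈ Y₁.toList ++ C.toList} = ((C ∪ Y₁ : Finset E) : Set E) := by
          intro C
          ext e
          simp [or_comm]
        -- Independence of the concatenated list also forces it to have no repetition, which yields
        -- disjointness.
        have h_list : ∀ C ∈ B, (LinearIndependent F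
            (Y₁.toList.map (φ ∘ g) ++ C.toList.map (φ ∘ g)).get ↔
              Disjoint C Y₁ ∧ LinearIndepOn F g (X ∪ (C ∪ Y₁) : Finset E)) := by
          intro C hC
          rw [← List.map_append, linearIndependent_map_get_iff, h_coe,
            h_iff (Finset.disjoint_union_right.2 ⟨hBX C hC, hXY₁⟩), Finset.coe_union X,
            List.nodup_append, Finset.disjoint_right]
          simp only [Finset.nodup_toList, true_and, Finset.mem_toList]
          refine and_congr_left fun _ => ⟨fun h e he he' => h e he e he' rfl,
            fun h e he e' he' hee => h he (hee ▸ he')⟩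
        obtain ⟨Y', hY', hw, h'⟩ := hT₂ Y hY (Y₁.toList.map (φ ∘ g)) (by
          rw [List.length_map, Finset.length_toList, hY₁]
          omega) (by
            rw [h_map]
            exact (h_list Y hY).2 ⟨hYY₁, h_ind⟩)
        rw [h_map] at h'
        obtain ⟨h₁, h₂⟩ := (h_list Y' (hTB hY')).1 h'
        exact ⟨Y', hY', h₁, h₂, hw⟩)
  refine h_select.mono subset_rfl subset_rfl ?_
  rw [h_card]

end Select

open RepFamily

/-! ### Two rounds of representation for a product family -/

section Product

/-- Two rounds of representation, the first after the contraction of each set of the first family,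
give a min representative subfamily of a product family. -/
theorem isMinRep_product {F : Type u} [Field F] {E : Type v} [Fintype E] [DecidableEq E] {k : ℕ}
    {A : Matrix (Fin k) E F} {M : Matroid E} (hA : Represents A M) (hM : M.eRank = k)
    {L₁ L₂ : Finset (Finset E)} {i j : ℕ} (hij : i + j ≤ k) (w : Finset E → ℕ)
    (o : Finset E → Finset (Finset E))
    (ho : ∀ X ∈ L₁.slice i, o X ⊆ (L₂.slice j).filter (Disjoint X))
    (ho' : ∀ X ∈ L₁.slice i, ContractRep (F := F) A.col X (k - X.card - j) (fun Y => w (X ∪ Y))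
      (o X) ((L₂.slice j).filter (Disjoint X)))
    (S : Finset (Finset E)) (hS : S ⊆ (L₁.slice i).biUnion fun X => (o X).image (X ∪ ·))
    (hS' : ContractRep (F := F) A.col ∅ (k - (∅ : Finset E).card - (i + j)) w S
      ((L₁.slice i).biUnion fun X => (o X).image (X ∪ ·))) :
    IsMinRep M (k - i - j) w S (product M (L₁.slice i) (L₂.slice j)) := by
  constructor
  · intro Z hZ
    obtain ⟨X, hX, hZ'⟩ := Finset.mem_biUnion.1 (hS hZ)
    obtain ⟨Y, hY, rfl⟩ := Finset.mem_image.1 hZ'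
    obtain ⟨hY₂, hXY⟩ := Finset.mem_filter.1 (ho X hX hY)
    exact ⟨X, hX, Y, hY₂, hXY, (hA.2 _).2 ((ho' X hX).1 Y hY), rfl⟩
  · rintro Y₀ hY₀ _ ⟨X, hX, Y, hY, hXY, -, rfl⟩ h_disj h_ind
    obtain ⟨hX₁, hXi⟩ := Finset.mem_slice.1 hX
    obtain ⟨hY₁, hYj⟩ := Finset.mem_slice.1 hY
    -- The exterior product test needs a complement of full size. So Y₀ is enlarged to the rest Y₁
    -- of a base, of size exactly k - i - j; what holds for Y₁ passes to its subset Y₀.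
    obtain ⟨Bs, hBs, h_sub⟩ := h_ind.exists_isBase_superset
    lift Bs to Finset E using Bs.toFinite
    have h_sub' : (X ∪ Y) ∪ Y₀ ⊆ Bs := Finset.coe_subset.1 h_sub
    have h_card : Bs.card = k := by
      have := hBs.encard_eq_eRank
      rw [hM, Set.encard_coe_eq_coe_finsetCard] at this
      exact_mod_cast this
    set Y₁ := Bs \ (X ∪ Y) with hY₁_def
    have hXY_sub : X ∪ Y ⊆ Bs := Finset.union_subset_left h_sub'
    have hY₀₁ : Y₀ ⊆ Y₁ := fun e he => Finset.mem_sdiff.2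
      ⟨h_sub' (Finset.mem_union_right _ he), fun he' => Finset.disjoint_left.1 h_disj he' he⟩
    have h_card₁ : Y₁.card = k - (i + j) := by
      rw [hY₁_def, Finset.card_sdiff_of_subset hXY_sub, Finset.card_union_of_disjoint hXY, h_card,
        hXi, hYj]
    have h_disj₁ : Disjoint (X ∪ Y) Y₁ := Finset.disjoint_sdiff
    rw [Finset.disjoint_union_left] at h_disj₁
    -- First exchange, in M/X: Y for Y', against Y₁.
    obtain ⟨Y', hY', h₁, h₂, h₃⟩ := (ho' X hX).2 Y (Finset.mem_filter.2 ⟨hY, hXY⟩) Y₁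
      (by rw [h_card₁, hXi]; omega) h_disj₁.2 h_disj₁.1 (by
        rw [← Finset.union_assoc, hY₁_def, Finset.union_sdiff_of_subset hXY_sub]
        exact (hA.2 _).1 hBs.indep)
    -- Second exchange, in M: X ∪ Y' for Z, against the same Y₁.
    obtain ⟨Z, hZ, h₄, h₅, h₆⟩ := hS'.2 (X ∪ Y')
      (Finset.mem_biUnion.2 ⟨X, hX, Finset.mem_image_of_mem _ hY'⟩) Y₁
      (by rw [h_card₁, Finset.card_empty]; omega)
      (Finset.disjoint_union_left.2 ⟨h_disj₁.1, h₁⟩) (Finset.disjoint_empty_left _) (by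
        rwa [Finset.empty_union, Finset.union_assoc])
    refine ⟨Z, hZ, h₄.mono_right hY₀₁, ?_, h₆.trans h₃⟩
    rw [Finset.empty_union] at h₅
    exact ((hA.2 _).2 h₅).subset (Finset.coe_subset.2 (Finset.union_subset_union_right hY₀₁))

theorem product_slice_eq_empty {E : Type v} [DecidableEq E] {k : ℕ}
    {M : Matroid E} (hM : M.eRank = k) (L₁ L₂ : Finset (Finset E)) {i j : ℕ} (hij : k < i + j) :
    product M (L₁.slice i) (L₂.slice j) = ∅ := by
  refine Set.eq_empty_of_forall_notMem ?_
  rintro _ ⟨X, hX, Y, hY, hXY, h_ind, rfl⟩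
  have h_le := h_ind.encard_le_eRank
  rw [hM, Set.encard_coe_eq_coe_finsetCard, Finset.card_union_of_disjoint hXY,
    (Finset.mem_slice.1 hX).2, (Finset.mem_slice.1 hY).2] at h_le
  have : i + j ≤ k := by exact_mod_cast h_le
  omega

/-- The cost of a representation among `b` sets of size `j` after the contraction of `i`
elements. -/
noncomputable def repCost (ω C₀ : ℝ) (k i j : ℕ) (b : ℝ) (n : ℕ) : ℝ :=
  i * k * (8 * (C₀ + 1) * (k : ℝ) ^ (ω - 2) + 2) * (i + 1) +
    (b * (j * ((k - i : ℕ) * (2 * i + 2))) +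
    (b * ((j + 1) * (2 ^ (k - i) * (5 * (k - i : ℕ) + 1))) +
    b * (k - i).choose j * (8 * (C₀ + 1) * ((k - i).choose j : ℝ) ^ (ω - 2) + 2) * (n + 1)))

/-- The cost of a representation for one pair of sizes. -/
noncomputable def pairCost (ω C₀ : ℝ) (c k i j : ℕ) : ℝ :=
  if i + j ≤ k then
    (k + c).choose i * repCost ω C₀ k i j ((k + c).choose j) (k + c) +
      repCost ω C₀ k 0 (i + j) ((k + c).choose i * (k - i).choose j) (k + c + k)
  else 0

theorem repCost_mono {ω C₀ : ℝ} (hC₀ : 0 ≤ C₀) {k i j : ℕ} {b b' : ℝ} {n : ℕ}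
    (hb : b ≤ b') : repCost ω C₀ k i j b n ≤ repCost ω C₀ k i j b' n := by
  unfold repCost
  gcongr

theorem repCost_nonneg {ω C₀ : ℝ} (hC₀ : 0 ≤ C₀) {k i j : ℕ} {b : ℝ} (hb : 0 ≤ b) {n : ℕ} :
    0 ≤ repCost ω C₀ k i j b n := by
  unfold repCost
  positivity

/-- The requirements on the family found for the sizes `i` and `j`. -/
def PairSpec {F : Type u} [Field F] {E : Type v} [DecidableEq E] (k : ℕ)
    (L₁ L₂ : Finset (Finset E)) (w : ℕ → ℕ → Finset E → ℕ) (p : ℕ × ℕ) (S : Finset (Finset E))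
    (x : Fin k × E → F) : Prop :=
  S.card ≤ k.choose (p.1 + p.2) ∧ ∀ M : Matroid E,
    Represents (Matrix.of fun r e => x (r, e)) M → M.eRank = k →
    IsMinRep M (k - p.1 - p.2) (w p.1 p.2) S (product M (L₁.slice p.1) (L₂.slice p.2))

/-- Finding a min representative subfamily for one pair of sizes. -/
theorem MatMulExponent.feasible_pair {F : Type u} [Field F] {ι β : Type v} [Nonempty β] {ω C₀ : ℝ}
    (h : MatMulExponent F ω C₀) {E : Type v} [Fintype E] [DecidableEq E] {k c : ℕ} (hk : k ≠ 0)
    (L₁ L₂ : Finset (Finset E)) (w : ℕ → ℕ → Finset E → ℕ)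
    (hL₁ : ∀ p : ℕ, (L₁.slice p).card ≤ (k + c).choose p)
    (hL₂ : ∀ p : ℕ, (L₂.slice p).card ≤ (k + c).choose p) (p : ℕ × ℕ)
    {D : Set (Fin k × E → F)} {G : Set ((Fin k × E → F) → F)} {c' : ℝ}
    {Q : (Fin k × E → F) → β → Prop} (hG : ∀ e r, (fun x => x (r, e)) ∈ G)
    (hD : ∀ x ∈ D, ∀ X ∈ L₁, LinearIndepOn F (Matrix.of fun r e => x (r, e)).col X)
    (H : ∀ S, ∀ D' ⊆ D, (∀ x ∈ D', PairSpec k L₁ L₂ w p S x) → Feasible ι D' G c' Q) :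
    Feasible ι D G (c' + pairCost ω C₀ c k p.1 p.2) Q := by
  have h_C₀ := h.one_le
  obtain ⟨i, j⟩ := p
  by_cases hij : i + j ≤ k
  · rw [pairCost, if_pos hij]
    set a : E → Fin k → (Fin k × E → F) → F := fun e r x => x (r, e) with ha
    set B : Finset E → Finset (Finset E) := fun X => (L₂.slice j).filter (Disjoint X) with hB
    have hB_card : ∀ X, (B X).card ≤ (k + c).choose j := fun X =>
      (Finset.card_filter_le _ _).trans (hL₂ j)
    -- The halving depths k + c and k + c + k come from binom(k+c,j) ≤ 2^(k+c) and binom(k+c,i)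
    -- binom(k-i,j) ≤ 2^(k+c) 2^k. The second round contracts the empty set.
    set c₁ := repCost ω C₀ k 0 (i + j) ((k + c).choose i * (k - i).choose j) (k + c + k) with hc₁
    set c₂ := repCost ω C₀ k i j ((k + c).choose j) (k + c) with hc₂
    have hc₂_nonneg : 0 ≤ c₂ := repCost_nonneg (by linarith) (by positivity)
    refine (Feasible.forall_finset (ι := ι) (G := G) (Q := Q) (D := D) (c := c' + c₁)
      (fun X S x => S ⊆ B X ∧ S.card ≤ (k - i).choose j ∧
        ContractRep (F := F) (fun e r => a e r x) X (k - X.card - j) (fun Y => w i j (X ∪ Y)) S (B X))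
      (fun _ => c₂) (L₁.slice i) ?_ subset_rfl ?_).mono subset_rfl subset_rfl ?_
    · intro X hX D₁ hD₁ d Hd
      obtain ⟨hX₁, hXi⟩ := Finset.mem_slice.1 hX
      refine (h.feasible_contractRep (ι := ι) (c := d) hk a X j (by omega) (B X)
        (fun Y hY => (Finset.mem_slice.1 (Finset.mem_filter.1 hY).1).2)
        (fun Y hY => (Finset.mem_filter.1 hY).2) (fun Y => w i j (X ∪ Y)) (k + c)
        ((hB_card X).trans (Nat.choose_le_two_pow _ _)) (fun e r => hG e r)
        (fun x hx => hD x (hD₁ hx) X hX₁) ?_).mono subset_rfl subset_rfl ?_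
      · intro S hS hSc D₂ hD₂ hS'
        exact Hd S D₂ hD₂ fun x hx => ⟨hS, hXi ▸ hSc, hS' x hx⟩
      · rw [hXi]
        exact add_le_add_right (repCost_mono (by linarith) (by exact_mod_cast hB_card X)) d
    · intro o D₁ hD₁ ho
      refine Feasible.of_nonempty fun ⟨x₁, hx₁⟩ => ?_
      set B' := (L₁.slice i).biUnion fun X => (o X).image (X ∪ ·) with hB'
      have hB'_card : B'.card ≤ (k + c).choose i * (k - i).choose j := by
        refine (Finset.card_biUnion_le_card_mul _ _ _ fun X hX => ?_).trans
          (Nat.mul_le_mul_right _ (hL₁ i))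
        exact Finset.card_image_le.trans (ho x₁ hx₁ X hX).2.1
      refine (h.feasible_contractRep (ι := ι) (c := c') hk a ∅ (i + j) (by simpa using hij) B' ?_
        (fun Y _ => Finset.disjoint_empty_left Y) (w i j) (k + c + k) ?_ (fun e r => hG e r)
        (fun x _ => by simp) ?_).mono subset_rfl subset_rfl ?_
      · intro Z hZ
        obtain ⟨X, hX, hZ'⟩ := Finset.mem_biUnion.1 hZ
        obtain ⟨Y, hY, rfl⟩ := Finset.mem_image.1 hZ'
        obtain ⟨hY₂, hXY⟩ := Finset.mem_filter.1 ((ho x₁ hx₁ X hX).1 hY)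
        rw [Finset.card_union_of_disjoint hXY, (Finset.mem_slice.1 hX).2,
          (Finset.mem_slice.1 hY₂).2]
      · rw [pow_add]
        exact hB'_card.trans (Nat.mul_le_mul (Nat.choose_le_two_pow _ _)
          ((Nat.choose_le_two_pow _ _).trans (Nat.pow_le_pow_right two_pos (Nat.sub_le _ _))))
      · intro S hS hSc D₂ hD₂ hS'
        refine H S D₂ (hD₂.trans hD₁) fun x hx => ⟨by simpa using hSc, fun M hA hM => ?_⟩
        exact isMinRep_product hA hM hij (w i j) o (fun X hX => (ho x₁ hx₁ X hX).1)
          (fun X hX => (ho x (hD₂ hx) X hX).2.2) S hS (hS' x hx)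
      · have := repCost_mono (ω := ω) (C₀ := C₀) (by linarith) (k := k) (i := 0) (j := i + j)
          (b := B'.card) (b' := (k + c).choose i * (k - i).choose j) (n := k + c + k)
          (by exact_mod_cast hB'_card)
        rw [Finset.card_empty]
        exact add_le_add_right this c'
    · rw [Finset.sum_const, nsmul_eq_mul]
      have : ((L₁.slice i).card : ℝ) * c₂ ≤ (k + c).choose i * c₂ :=
        mul_le_mul_of_nonneg_right (by exact_mod_cast hL₁ i) hc₂_nonneg
      linarith
  · rw [pairCost, if_neg hij, add_zero]
    refine H ∅ D subset_rfl fun x _ => ⟨by simp, fun M _ hM => ?_⟩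
    rw [product_slice_eq_empty hM L₁ L₂ (by omega)]
    exact ⟨by simp, fun _ _ X hX => absurd hX (Set.notMem_empty X)⟩

/-- The cost for all pairs of sizes together. -/
theorem MatMulExponent.feasible_all {F : Type u} [Field F] {ι : Type v} {ω C₀ : ℝ}
    (h : MatMulExponent F ω C₀) {E : Type v} [Fintype E] [DecidableEq E] {k c : ℕ} (hk : k ≠ 0)
    (L₁ L₂ : Finset (Finset E)) (w : ℕ → ℕ → Finset E → ℕ)
    (hL₁ : ∀ p : ℕ, (L₁.slice p).card ≤ (k + c).choose p)
    (hL₂ : ∀ p : ℕ, (L₂.slice p).card ≤ (k + c).choose p)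
    {D : Set (Fin k × E → F)} {G : Set ((Fin k × E → F) → F)} (hG : ∀ e r, (fun x => x (r, e)) ∈ G)
    (hD : ∀ x ∈ D, ∀ X ∈ L₁, LinearIndepOn F (Matrix.of fun r e => x (r, e)).col X) :
    Feasible ι D G (∑ p ∈ Finset.range (k + 1) ×ˢ Finset.range (k + 1), pairCost ω C₀ c k p.1 p.2)
      fun x (t : ℕ → ℕ → Finset (Finset E)) =>
        ∀ i ≤ k, ∀ j ≤ k, PairSpec k L₁ L₂ w (i, j) (t i j) x := by
  rw [← zero_add (∑ p ∈ _, _)]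
  refine Feasible.forall_finset (D := D) (fun p S x => PairSpec k L₁ L₂ w p S x) _ _
    (fun p _ D₁ hD₁ c' H => h.feasible_pair hk L₁ L₂ w hL₁ hL₂ p hG
      (fun x hx => hD x (hD₁ hx)) H) subset_rfl fun o D₁ _ ho => ?_
  refine Feasible.ret (fun i j => o (i, j)) fun x hx i hi j hj => ho x hx (i, j) ?_
  simp only [Finset.mem_product, Finset.mem_range]
  omega

end Product

/-! ### Summing the costs over all pairs of sizes -/

section CostBound

variable {ω C₀ : ℝ}

/-- The left side is a combination of s^(ω-1) and s, and s ≤ s^(ω-1) as ω ≥ 2. It is applied to s =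
binom(k-i,j) ≤ 2^(k-i). -/
theorem rpow_width_le (hω : 2 ≤ ω) (hC₀ : 0 ≤ C₀) {s m : ℕ} (hs : s ≤ 2 ^ m) :
    s * (8 * (C₀ + 1) * (s : ℝ) ^ (ω - 2) + 2) ≤ (8 * (C₀ + 1) + 2) * ((2 : ℝ) ^ (ω - 1)) ^ m := by
  rcases Nat.eq_zero_or_pos s with rfl | hs₀
  · simp only [Nat.cast_zero, zero_mul]
    positivity
  · have h_pos : (0 : ℝ) < s := by exact_mod_cast hs₀
    have h_one : (1 : ℝ) ≤ s := by exact_mod_cast hs₀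
    have h_mul : (s : ℝ) * (s : ℝ) ^ (ω - 2) = (s : ℝ) ^ (ω - 1) := by
      rw [← Real.rpow_one_add' h_pos.le (by linarith)]
      congr 1
      ring
    have h_self : (s : ℝ) ≤ (s : ℝ) ^ (ω - 1) := by
      conv_lhs => rw [← Real.rpow_one (s : ℝ)]
      exact Real.rpow_le_rpow_of_exponent_le h_one (by linarith)
    have h_le : (s : ℝ) ^ (ω - 1) ≤ ((2 : ℝ) ^ (ω - 1)) ^ m := by
      rw [← Real.rpow_natCast, ← Real.rpow_mul (by norm_num), mul_comm (ω - 1), Real.rpow_mul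
        (by norm_num), Real.rpow_natCast]
      exact Real.rpow_le_rpow h_pos.le (by exact_mod_cast hs) (by linarith)
    calc s * (8 * (C₀ + 1) * (s : ℝ) ^ (ω - 2) + 2)
        = 8 * (C₀ + 1) * (s * (s : ℝ) ^ (ω - 2)) + 2 * s := by ring
      _ ≤ 8 * (C₀ + 1) * (s : ℝ) ^ (ω - 1) + 2 * (s : ℝ) ^ (ω - 1) := by
          rw [h_mul]
          gcongr
      _ = (8 * (C₀ + 1) + 2) * (s : ℝ) ^ (ω - 1) := by ring
      _ ≤ _ := by gcongr

theorem two_le_rpow (hω : 2 ≤ ω) : (2 : ℝ) ≤ 2 ^ (ω - 1) := by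
  conv_lhs => rw [← Real.rpow_one 2]
  exact Real.rpow_le_rpow_of_exponent_le (by norm_num) (by linarith)

theorem sq_le_rpow (hω : 2 ≤ ω) {k : ℕ} (hk : k ≠ 0) : (k : ℝ) * k ≤ (k : ℝ) ^ ω := by
  have h_one : (1 : ℝ) ≤ k := by exact_mod_cast Nat.one_le_iff_ne_zero.2 hk
  have := Real.rpow_le_rpow_of_exponent_le h_one hω
  rw [Real.rpow_two] at this
  linarith [sq (k : ℝ)]

/-- The cost of one round of representation, apart from that of the contraction. -/
theorem repCost_le (hω : 2 ≤ ω) (hC₀ : 0 ≤ C₀) {k i j c n : ℕ} {b : ℝ} (hb : 0 ≤ b) (hk : k ≠ 0)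
    (hij : i + j ≤ k) (hn : n + 1 ≤ (c + 3) * k) :
    repCost ω C₀ k i j b n ≤
      i * k * (8 * (C₀ + 1) * (k : ℝ) ^ (ω - 2) + 2) * (i + 1) +
        b * ((k : ℝ) ^ ω * ((16 + (c + 3) * (8 * (C₀ + 1) + 2)) *
          ((2 : ℝ) ^ (ω - 1)) ^ (k - i))) := by
  have h_one : (1 : ℝ) ≤ k := by exact_mod_cast Nat.one_le_iff_ne_zero.2 hk
  have h_sq := sq_le_rpow hω hk
  set P := (k : ℝ) ^ ω with hP
  set z := ((2 : ℝ) ^ (ω - 1)) ^ (k - i) with hz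
  have h_two : (2 : ℝ) ^ (k - i) ≤ z := pow_le_pow_left₀ (by norm_num) (two_le_rpow hω) _
  have h_sub : ((k - i : ℕ) : ℝ) ≤ (2 : ℝ) ^ (k - i) := by
    exact_mod_cast (Nat.lt_two_pow_self (n := k - i)).le
  have h_z : (0 : ℝ) ≤ z := by positivity
  have hi : (i : ℝ) ≤ k := by exact_mod_cast (by omega : i ≤ k)
  have hj : (j : ℝ) ≤ k := by exact_mod_cast (by omega : j ≤ k)
  have hki : ((k - i : ℕ) : ℝ) ≤ k := by exact_mod_cast Nat.sub_le k i
  have h_kP : (k : ℝ) ≤ P := by nlinarith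
  have h_width := rpow_width_le (ω := ω) (C₀ := C₀) hω hC₀ (Nat.choose_le_two_pow (k - i) j)
  rw [← hz] at h_width
  have hnR : (n : ℝ) + 1 ≤ (c + 3) * k := by exact_mod_cast hn
  have h₁ : (j : ℝ) * ((k - i : ℕ) * (2 * i + 2)) ≤ 4 * (P * z) := by
    calc (j : ℝ) * ((k - i : ℕ) * (2 * i + 2)) ≤ k * (z * (2 * k + 2 * k)) := by
          gcongr
          · exact h_sub.trans h_two
          · linarith
      _ = 4 * (k * k * z) := by ring
      _ ≤ 4 * (P * z) := by gcongr
  have h₂ : ((j : ℝ) + 1) * (2 ^ (k - i) * (5 * (k - i : ℕ) + 1)) ≤ 12 * (P * z) := by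
    calc ((j : ℝ) + 1) * (2 ^ (k - i) * (5 * (k - i : ℕ) + 1))
        ≤ (k + k) * (z * (5 * k + k)) := by gcongr
      _ = 12 * (k * k * z) := by ring
      _ ≤ 12 * (P * z) := by gcongr
  have h₃ : ((k - i).choose j : ℝ) * (8 * (C₀ + 1) * ((k - i).choose j : ℝ) ^ (ω - 2) + 2) *
      (n + 1) ≤ (c + 3) * (8 * (C₀ + 1) + 2) * (P * z) := by
    calc ((k - i).choose j : ℝ) * (8 * (C₀ + 1) * ((k - i).choose j : ℝ) ^ (ω - 2) + 2) * (n + 1)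
        ≤ ((8 * (C₀ + 1) + 2) * z) * ((c + 3) * k) := by gcongr
      _ = (c + 3) * (8 * (C₀ + 1) + 2) * (k * z) := by ring
      _ ≤ (c + 3) * (8 * (C₀ + 1) + 2) * (P * z) := by gcongr
  unfold repCost
  have h_sum := mul_le_mul_of_nonneg_left (add_le_add (add_le_add h₁ h₂) h₃) hb
  linarith

/-- Two factors k join k^(ω-2) to form k^ω; the halving depth leaves the factor k + 1, which
`sq_mul_pow_le` absorbs later. -/
theorem contractionCost_le (hω : 2 ≤ ω) (hC₀ : 0 ≤ C₀) {k i : ℕ} (hk : k ≠ 0) (hi : i ≤ k) :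
    i * k * (8 * (C₀ + 1) * (k : ℝ) ^ (ω - 2) + 2) * (i + 1) ≤
      (k : ℝ) ^ ω * ((8 * (C₀ + 1) + 2) * (k + 1)) := by
  have h_one : (1 : ℝ) ≤ k := by exact_mod_cast Nat.one_le_iff_ne_zero.2 hk
  have h_pos : (0 : ℝ) < k := by linarith
  have h_sq := sq_le_rpow hω hk
  have hiR : (i : ℝ) ≤ k := by exact_mod_cast hi
  have h_rpow : (k : ℝ) * k * (k : ℝ) ^ (ω - 2) = (k : ℝ) ^ ω := by
    rw [Real.rpow_sub h_pos, Real.rpow_two]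
    field_simp
  calc i * k * (8 * (C₀ + 1) * (k : ℝ) ^ (ω - 2) + 2) * (i + 1)
      ≤ k * k * (8 * (C₀ + 1) * (k : ℝ) ^ (ω - 2) + 2) * (k + 1) := by gcongr
    _ = (8 * (C₀ + 1) * (k * k * (k : ℝ) ^ (ω - 2)) + 2 * (k * k)) * (k + 1) := by ring
    _ ≤ (8 * (C₀ + 1) * (k : ℝ) ^ ω + 2 * (k : ℝ) ^ ω) * (k + 1) := by
        rw [h_rpow]
        gcongr
    _ = _ := by ring

theorem sum_choose_le (k c : ℕ) :
    ∑ j ∈ Finset.range (k + 1), ((k + c).choose j : ℝ) ≤ 2 ^ (k + c) := by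
  have : ∑ j ∈ Finset.range (k + 1), (k + c).choose j ≤ 2 ^ (k + c) := by
    rw [← Nat.sum_range_choose]
    exact Finset.sum_le_sum_of_subset (Finset.range_mono (by omega))
  exact_mod_cast this

/-- A truncated binomial expansion; z ≥ 1 allows raising the exponent k - i to k + c - i. -/
theorem sum_choose_mul_pow_le (k c : ℕ) {z : ℝ} (hz : 1 ≤ z) :
    ∑ i ∈ Finset.range (k + 1), ((k + c).choose i : ℝ) * z ^ (k - i) ≤ (1 + z) ^ (k + c) := by
  have h_nonneg : 0 ≤ z := by linarith
  rw [add_pow]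
  calc ∑ i ∈ Finset.range (k + 1), ((k + c).choose i : ℝ) * z ^ (k - i)
      ≤ ∑ i ∈ Finset.range (k + 1), 1 ^ i * z ^ (k + c - i) * ((k + c).choose i : ℝ) := by
        refine Finset.sum_le_sum fun i _ => ?_
        rw [one_pow, one_mul, mul_comm]
        gcongr
        omega
    _ ≤ _ := by
        refine Finset.sum_le_sum_of_subset_of_nonneg (Finset.range_mono (by omega)) ?_
        intros
        positivity

/-- One factor k + 1 is at most 2^k, the other at most 2(3/2)^k by Bernoulli, and 6 = (3/2)·2·2.
Contractions, repeated for each j, thus stay below (2^ω+2)^k, as 6 ≤ 2^ω + 2. -/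
theorem sq_mul_pow_le (k : ℕ) : ((k : ℝ) + 1) * (k + 1) * 2 ^ k ≤ 4 * 6 ^ k := by
  have h_bern : 1 + (k : ℝ) * (1 / 2) ≤ (1 + 1 / 2) ^ k :=
    one_add_mul_le_pow (by norm_num) k
  have h_two : (k : ℝ) + 1 ≤ 2 ^ k := by exact_mod_cast Nat.lt_two_pow_self (n := k)
  have h_six : (6 : ℝ) ^ k = (1 + 1 / 2) ^ k * 2 ^ k * 2 ^ k := by
    rw [← mul_pow, ← mul_pow]
    norm_num
  have h_k : (k : ℝ) + 1 ≤ 2 * (1 + 1 / 2) ^ k := by linarith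
  rw [h_six]
  calc ((k : ℝ) + 1) * (k + 1) * 2 ^ k ≤ 2 * (1 + 1 / 2) ^ k * 2 ^ k * 2 ^ k := by gcongr
    _ ≤ _ := by
      have : (0 : ℝ) ≤ (1 + 1 / 2) ^ k * 2 ^ k * 2 ^ k := by positivity
      linarith

/-- The total cost. -/
theorem sum_pairCost_le (hω : 2 ≤ ω) (hC₀ : 0 ≤ C₀) (c : ℕ) {k : ℕ} (hk : k ≠ 0) :
    ∑ p ∈ Finset.range (k + 1) ×ˢ Finset.range (k + 1), pairCost ω C₀ c k p.1 p.2 ≤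
      ((8 * (C₀ + 1) + 2) * 4 * 2 ^ c +
        (16 + (c + 3) * (8 * (C₀ + 1) + 2)) * ((2 ^ ω + 2) ^ c + 3 ^ c)) *
      ((k : ℝ) ^ ω * ((2 : ℝ) ^ ω + 2) ^ k +
        (k : ℝ) ^ ω * (2 : ℝ) ^ ((k : ℝ) * (ω - 1)) * (3 : ℝ) ^ k) := by
  set K := 8 * (C₀ + 1) + 2 with hK
  set R := 16 + (c + 3) * K with hR
  set P := (k : ℝ) ^ ω with hP
  set z := (2 : ℝ) ^ (ω - 1) with hz
  have hK₀ : 0 ≤ K := by positivity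
  have hR₀ : 0 ≤ R := by positivity
  have hP₀ : 0 ≤ P := by positivity
  have h_z2 : 2 ≤ z := two_le_rpow hω
  -- The three terms are the contractions of the sets X, the first round in M/X, and the second
  -- round in M.
  have h_pair : ∀ i ≤ k, ∀ j ≤ k, pairCost ω C₀ c k i j ≤
      P * (K * (k + 1)) * (k + c).choose i +
      P * R * ((k + c).choose i * z ^ (k - i) * (k + c).choose j) +
      P * R * z ^ k * ((k + c).choose i * (k - i).choose j) := by
    intro i hi j hj
    unfold pairCost
    split_ifs with hij
    · have h₁ := repCost_le hω hC₀ (k := k) (i := i) (j := j) (c := c) (n := k + c)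
        (b := (k + c).choose j) (by positivity) hk hij (by
          have := Nat.pos_of_ne_zero hk
          nlinarith)
      have h₂ := repCost_le hω hC₀ (k := k) (i := 0) (j := i + j) (c := c) (n := k + c + k)
        (b := (k + c).choose i * (k - i).choose j) (by positivity) hk (by omega) (by
          have := Nat.pos_of_ne_zero hk
          nlinarith)
      have h₃ := contractionCost_le (ω := ω) hω hC₀ hk hi
      have h₄ := mul_le_mul_of_nonneg_left (h₁.trans (add_le_add_left h₃ _))
        (by positivity : (0 : ℝ) ≤ (k + c).choose i)
      simp only [Nat.cast_zero, zero_mul, Nat.sub_zero, zero_add] at h₂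
      linarith
    · positivity
  have h_sum_i := sum_choose_le k c
  have h_sum_z := sum_choose_mul_pow_le k c (z := z) (by linarith)
  have h_sum_3 := sum_choose_mul_pow_le k c (z := 2) (by norm_num)
  have h_two_z : 2 * (1 + z) = 2 ^ ω + 2 := by
    rw [hz, Real.rpow_sub (by norm_num), Real.rpow_one]
    ring
  have h_zk : z ^ k = (2 : ℝ) ^ ((k : ℝ) * (ω - 1)) := by
    rw [hz, ← Real.rpow_natCast, ← Real.rpow_mul (by norm_num), mul_comm]
  have h_six : (6 : ℝ) ^ k ≤ (2 ^ ω + 2) ^ k :=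
    pow_le_pow_left₀ (by norm_num) (by rw [← h_two_z]; linarith) k
  set T := ((2 : ℝ) ^ ω + 2) with hT
  have hT₀ : 0 ≤ T := by positivity
  rw [← h_zk]
  have h₁ : ∑ i ∈ Finset.range (k + 1), ∑ j ∈ Finset.range (k + 1),
      P * (K * (k + 1)) * ((k + c).choose i : ℝ) ≤ P * K * 4 * 2 ^ c * T ^ k := by
    simp only [Finset.sum_const, Finset.card_range, nsmul_eq_mul]
    rw [← Finset.mul_sum, ← Finset.mul_sum]
    have := sq_mul_pow_le k
    push_cast
    calc ((k : ℝ) + 1) * (P * (K * (k + 1)) * ∑ i ∈ Finset.range (k + 1), ((k + c).choose i : ℝ))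
        ≤ ((k : ℝ) + 1) * (P * (K * (k + 1)) * 2 ^ (k + c)) := by gcongr
      _ = P * K * 2 ^ c * ((k + 1) * (k + 1) * 2 ^ k) := by rw [pow_add]; ring
      _ ≤ P * K * 2 ^ c * (4 * T ^ k) :=
          mul_le_mul_of_nonneg_left (by linarith) (by positivity)
      _ = _ := by ring
  have h₂ : ∑ i ∈ Finset.range (k + 1), ∑ j ∈ Finset.range (k + 1),
      P * R * ((k + c).choose i * z ^ (k - i) * (k + c).choose j) ≤ P * R * T ^ c * T ^ k := by
    simp only [← Finset.mul_sum]
    rw [← Finset.sum_mul]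
    calc P * R * ((∑ i ∈ Finset.range (k + 1), (k + c).choose i * z ^ (k - i)) *
          ∑ j ∈ Finset.range (k + 1), ((k + c).choose j : ℝ))
        ≤ P * R * ((1 + z) ^ (k + c) * 2 ^ (k + c)) := by gcongr
      _ = P * R * T ^ c * T ^ k := by
          rw [← mul_pow, mul_comm (1 + z), h_two_z, pow_add]
          ring
  have h₃ : ∑ i ∈ Finset.range (k + 1), ∑ j ∈ Finset.range (k + 1),
      P * R * z ^ k * ((k + c).choose i * (k - i).choose j) ≤ P * R * z ^ k * (3 ^ c * 3 ^ k) := by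
    simp only [← Finset.mul_sum]
    have h_inner : ∀ i, ∑ j ∈ Finset.range (k + 1), ((k - i).choose j : ℝ) ≤ 2 ^ (k - i) := by
      intro i
      have : ∑ j ∈ Finset.range (k + 1), (k - i).choose j ≤ 2 ^ (k - i) := by
        rw [← Nat.sum_range_choose]
        refine (Finset.sum_subset (Finset.range_mono (by omega)) fun j _ hj => ?_).ge
        rw [Finset.mem_range] at hj
        exact Nat.choose_eq_zero_of_lt (by omega)
      exact_mod_cast this
    have h_outer : ∑ i ∈ Finset.range (k + 1), ((k + c).choose i : ℝ) *
        ∑ j ∈ Finset.range (k + 1), ((k - i).choose j : ℝ) ≤ 3 ^ c * 3 ^ k := by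
      refine (Finset.sum_le_sum fun i _ => mul_le_mul_of_nonneg_left (h_inner i)
        (by positivity)).trans (h_sum_3.trans_eq ?_)
      rw [pow_add]
      norm_num
      ring
    gcongr
  rw [Finset.sum_product]
  calc ∑ i ∈ Finset.range (k + 1), ∑ j ∈ Finset.range (k + 1), pairCost ω C₀ c k i j
      ≤ ∑ i ∈ Finset.range (k + 1), ∑ j ∈ Finset.range (k + 1),
          (P * (K * (k + 1)) * (k + c).choose i +
            P * R * ((k + c).choose i * z ^ (k - i) * (k + c).choose j) +
            P * R * z ^ k * ((k + c).choose i * (k - i).choose j)) :=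
        Finset.sum_le_sum fun i hi => Finset.sum_le_sum fun j hj => h_pair i
          (by simpa [Nat.lt_succ_iff] using hi) j (by simpa [Nat.lt_succ_iff] using hj)
    _ ≤ P * K * 4 * 2 ^ c * T ^ k + P * R * T ^ c * T ^ k +
          P * R * z ^ k * (3 ^ c * 3 ^ k) := by
        simp only [Finset.sum_add_distrib]
        linarith
    _ ≤ _ := by
        have e₁ : 0 ≤ K * 4 * 2 ^ c * (P * z ^ k * 3 ^ k) := by positivity
        have e₂ : 0 ≤ R * T ^ c * (P * z ^ k * 3 ^ k) := by positivity
        have e₃ : 0 ≤ R * 3 ^ c * (P * T ^ k) := by positivity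
        linarith

end CostBound

end FieldComp

/-! ### Assembly of the algorithm -/

theorem mainTheorem8 (ω C₀ : ℝ) (c : ℕ) :
    ∃ C : ℝ, ∀ (F : Type u) [Field F], FieldComp.MatMulExponent F ω C₀ →
      ∀ (E : Type v) [Fintype E] [DecidableEq E] (k : ℕ) (L₁ L₂ : Finset (Finset E))
        (w : ℕ → ℕ → Finset E → ℕ),
        (∀ p : ℕ, (L₁.slice p).card ≤ (k + c).choose p) →
        (∀ p : ℕ, (L₂.slice p).card ≤ (k + c).choose p) →
        ∃ t : FieldComp.CompTree F (Fin k × E) (ℕ → ℕ → Finset (Finset E)),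
          ∀ (M : Matroid E) (A : Matrix (Fin k) E F),
            RepFamily.Represents A M → M.eRank = k →
            (∀ X ∈ L₁, M.Indep (X : Set E)) → (∀ X ∈ L₂, M.Indep (X : Set E)) →
            (∀ i ≤ k, ∀ j ≤ k,
              (t.result (FieldComp.initMem fun p => A p.1 p.2) i j).card ≤ k.choose (i + j) ∧
              RepFamily.IsMinRep M (k - i - j) (w i j)
                (t.result (FieldComp.initMem fun p => A p.1 p.2) i j : Set (Finset E))
                (RepFamily.product M (L₁.slice i) (L₂.slice j))) ∧
            (t.cost (FieldComp.initMem fun p => A p.1 p.2) : ℝ) ≤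
              C * ((k : ℝ) ^ ω * ((2 : ℝ) ^ ω + 2) ^ k +
                (k : ℝ) ^ ω * (2 : ℝ) ^ ((k : ℝ) * (ω - 1)) * (3 : ℝ) ^ k) := by
  refine ⟨(8 * (C₀ + 1) + 2) * 4 * 2 ^ c +
    (16 + (c + 3) * (8 * (C₀ + 1) + 2)) * ((2 ^ ω + 2) ^ c + 3 ^ c), ?_⟩
  intro F _ h E _ _ k L₁ L₂ w hL₁ hL₂
  have h_C₀ := h.one_le
  rcases eq_or_ne k 0 with rfl | hk
  -- For k = 0 the bound is 0, since ω ≥ 2, so no operation may be spent; the product is read off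
  -- from the families themselves.
  · refine ⟨.ret fun _ _ => if ∅ ∈ L₁ ∧ ∅ ∈ L₂ then {∅} else ∅, ?_⟩
    intro M A _ hM _ _
    refine ⟨fun i hi j hj => ?_, ?_⟩
    · obtain rfl := Nat.le_zero.1 hi
      obtain rfl := Nat.le_zero.1 hj
      have h_prod : RepFamily.product M (L₁.slice 0) (L₂.slice 0) =
          ((if ∅ ∈ L₁ ∧ ∅ ∈ L₂ then {∅} else ∅ : Finset (Finset E)) : Set (Finset E)) := by
        ext Z
        simp only [RepFamily.product, Finset.mem_slice, Finset.card_eq_zero]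
        split_ifs with h₀
        · simp only [Finset.coe_singleton, Set.mem_singleton_iff]
          constructor
          · rintro ⟨X, ⟨_, rfl⟩, Y, ⟨_, rfl⟩, _, _, rfl⟩
            rfl
          · rintro rfl
            exact ⟨∅, ⟨h₀.1, rfl⟩, ∅, ⟨h₀.2, rfl⟩, by simp, by simp, by simp⟩
        · simp only [Finset.coe_empty, Set.mem_empty_iff_false, iff_false]
          rintro ⟨X, ⟨hX, rfl⟩, Y, ⟨hY, rfl⟩, _⟩
          exact h₀ ⟨hX, hY⟩
      rw [h_prod]
      simp only [FieldComp.CompTree.result]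
      refine ⟨?_, subset_rfl, fun Y _ X hX hXY h_ind => ⟨X, hX, hXY, h_ind, le_rfl⟩⟩
      split_ifs <;> simp
    · simp only [FieldComp.CompTree.cost, Nat.cast_zero]
      positivity
  · let D : Set (Fin k × E → F) :=
      {x | ∀ X ∈ L₁, LinearIndepOn F (Matrix.of fun r e => x (r, e)).col X}
    let G : Set ((Fin k × E → F) → F) := Set.range fun p x => x p
    classical
    -- At the start the known quantities are the matrix entries, each in its input register; no work
    -- register is occupied, hence N = 0 below.
    have h_loc : ∀ g : (Fin k × E → F) → F, ∃ r : FieldComp.Reg (Fin k × E), g ∈ G →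
        ∃ p, r = Sum.inl p ∧ g = fun x => x p := by
      intro g
      by_cases hg : g ∈ G
      · obtain ⟨p, rfl⟩ := hg
        exact ⟨Sum.inl p, fun _ => ⟨p, rfl, rfl⟩⟩
      · exact ⟨Sum.inr 0, fun hg' => absurd hg' hg⟩
    choose loc hloc using h_loc
    obtain ⟨t, ht⟩ := h.feasible_all (ι := Fin k × E) hk L₁ L₂ w hL₁ hL₂ (D := D) (G := G)
      (fun e r => ⟨(r, e), rfl⟩) (fun x hx => hx) loc 0 (by
        intro g hg d hd
        obtain ⟨p, hp, _⟩ := hloc g hg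
        rw [hp] at hd
        exact absurd hd (by simp))
    refine ⟨t, fun M A hA hM hI₁ _ => ?_⟩
    have key := ht (fun p => A p.1 p.2) (fun X hX => (hA.2 X).1 (hI₁ X hX))
      (FieldComp.initMem fun p => A p.1 p.2) (by
        intro g hg
        obtain ⟨p, hp, hgp⟩ := hloc g hg
        rw [hp, hgp]
        rfl)
    refine ⟨fun i hi j hj => ⟨(key.1 i hi j hj).1, (key.1 i hi j hj).2 M hA hM⟩, ?_⟩
    exact key.2.trans (FieldComp.sum_pairCost_le h.two_le (by linarith) c hk)
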